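/- Let $K$ be a field of characteristic $0$, let $n\ge 0$, $\alpha,\beta\in K$ and $\phi\in K[t_1,\dots,t_n]$. Let $\mathbb A=\mathbb A(\alpha,\beta,\phi)$ be the $K$-algebra generated by $u,d,t_1,\dots,t_n$ subject to the relations $$t_it_j=t_jt_i,\quad t_iu=ut_i,\quad t_id=dt_i,\quad d^2u=\alpha\,dud+\beta\,ud^2+\phi\,d,\quad du^2=\alpha\,udu+\beta\,u^2d+u\,\phi .$$ Assume that $x^2-\alpha x-\beta=(x-r)(x-s)$ with $r,s\in K$. Put $$H=du-r\,ud+\frac{\phi}{s-1},\qquad L=du-s\,ud+\frac{\phi}{r-1},$$ where a term $\phi/(s-1)$ or $\phi/(r-1)$ is read as $0$ if $\phi=0$ (also when its denominator is $0$). ($H$ is used only if $s\ne1$ or $\phi=0$, and $L$ only if $r\neq 1$ or $\phi=0$.) Here $K[S,t_1,\dots,t_n]$ denotes the $K$-subalgebra of $\mathbb A$ generated by $S$ and $t_1,\dots,t_n$. The center $Z(\mathbb A)$ is as follows. 1. If $r=s$ is a primitive root of unity of order $m$, where $m\ge2$, or $m=1$ and $\phi=0$, then $Z(\mathbb A)=K[H^m,t_1,\dots,t_n]$.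 2. If $\alpha=2$, $\beta=-1$ and $\phi\ne0$, then $Z(\mathbb A)=K[(du-ud)^2-\phi\,(du+ud),t_1,\dots,t_n]$. 3. If $r$ is a primitive root of unity of order $m$, where $m\ge 2$, or $m=1$ and $\phi=0$, and $s$ is not a root of unity, then $Z(\mathbb A)=K[L^m,t_1,\dots,t_n]$. 4. If $s$ is a primitive root of unity of order $m$, where $m\ge 2$, or $m=1$ and $\phi=0$, and $r$ is not a root of unity, then $Z(\mathbb A)=K[H^m,t_1,\dots,t_n]$. 5. If $r\ne s$ and neither $r$ nor $s$ is a root of unity, then $Z(\mathbb A)$ is the subalgebra generated by $t_1,\dots,t_n$ and all $H^jL^i$ with integers $i,j\ge0$ such that $r^is^j=1$. 6. If $r\ne s$ are primitive roots of unity of orders $m_1$ and $m_2$, where $m_1,m_2\ge 2$, or $m_1,m_2\geq 1$ and $\phi=0$, and $m=\operatorname{lcm}(m_1,m_2)$, then $Z(\mathbb A)$ is the subalgebra generated by $d^m,u^m,t_1,\dots,t_n$ and all $H^iL^j$ with integers $i,j\ge0$ such that $s^ir^j=1$. 7. If $\phi\ne0$, $r=1$ and $s$ is a primitive root of unity of order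 $m>1$, then $Z(\mathbb A)=K[H^m,t_1,\dots,t_n]$. 8. If $\phi\ne0$, $s=1$ and $r$ is a primitive root of unity of order $m>1$, then $Z(\mathbb A)=K[L^m,t_1,\dots,t_n]$. 9. In all other cases, $Z(\mathbb A)=K[t_1,\dots,t_n]$. -/

import Mathlib

namespace DownUp

/-- The generators `u`, `d`, `t₁, …, tₙ`. -/
inductive Gen (n : ℕ) : Type
  | u : Gen n
  | d : Gen n
  | t (i : Fin n) : Gen n

/-- The polynomial `φ(t₁, …, tₙ)` written in the free algebra on `u, d, t₁, …, tₙ`, each monomial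
being written in the order `t₁ ^ m₁ * ⋯ * tₙ ^ mₙ`. -/
noncomputable def freePoly {K : Type*} [Field K] {n : ℕ} (φ : MvPolynomial (Fin n) K) :
    FreeAlgebra K (Gen n) :=
  ∑ m ∈ φ.support,
    φ.coeff m • (List.ofFn fun i : Fin n => FreeAlgebra.ι K (Gen.t i) ^ m i).prod

open FreeAlgebra in
/-- The defining relations of the down-up algebra over `K[t₁, …, tₙ]`. -/
inductive Rel {K : Type*} [Field K] {n : ℕ} (α β : K) (φ : MvPolynomial (Fin n) K) :
    FreeAlgebra K (Gen n) → FreeAlgebra K (Gen n) → Prop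
  | t_t (i j : Fin n) : Rel α β φ (ι K (.t i) * ι K (.t j)) (ι K (.t j) * ι K (.t i))
  | t_u (i : Fin n) : Rel α β φ (ι K (.t i) * ι K .u) (ι K .u * ι K (.t i))
  | t_d (i : Fin n) : Rel α β φ (ι K (.t i) * ι K .d) (ι K .d * ι K (.t i))
  | ddu : Rel α β φ (ι K .d ^ 2 * ι K .u)
      (α • (ι K .d * ι K .u * ι K .d) + β • (ι K .u * ι K .d ^ 2) + freePoly φ * ι K .d)
  | duu : Rel α β φ (ι K .d * ι K .u ^ 2)
      (α • (ι K .u * ι K .d * ι K .u) + β • (ι K .u ^ 2 * ι K .d) + ι K .u * freePoly φ)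

/-- The down-up algebra `𝔸(α, β, φ)`: the `K`-algebra generated by `u, d, t₁, …, tₙ` subject to
the relations `Rel α β φ`. -/
abbrev DownUpAlgebra {K : Type*} [Field K] {n : ℕ} (α β : K) (φ : MvPolynomial (Fin n) K) :
    Type _ :=
  RingQuot (Rel α β φ)

section Elements

variable {K : Type*} [Field K] {n : ℕ} (α β : K) (φ : MvPolynomial (Fin n) K)

/-- The image of a generator in the down-up algebra. -/
noncomputable def gen (g : Gen n) : DownUpAlgebra α β φ :=
  RingQuot.mkAlgHom K (Rel α β φ) (FreeAlgebra.ι K g)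

/-- The element `u`. -/
noncomputable def u : DownUpAlgebra α β φ := gen α β φ .u

/-- The element `d`. -/
noncomputable def d : DownUpAlgebra α β φ := gen α β φ .d

/-- The element `tᵢ`. -/
noncomputable def t (i : Fin n) : DownUpAlgebra α β φ := gen α β φ (.t i)

/-- The element `φ(t₁, …, tₙ)` of the down-up algebra. -/
noncomputable def phi : DownUpAlgebra α β φ := RingQuot.mkAlgHom K (Rel α β φ) (freePoly φ)

/-- The element `du - a ud + φ / (b - 1)`; it is `du - a ud` when `φ = 0`, whatever `b` is. -/
noncomputable def weightElt (a b : K) : DownUpAlgebra α β φ :=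
  d α β φ * u α β φ - a • (u α β φ * d α β φ) + (b - 1)⁻¹ • phi α β φ

/-- The `K`-subalgebra `K[S, t₁, …, tₙ]` generated by the set `S` and `t₁, …, tₙ`. -/
noncomputable def adjoinT (S : Set (DownUpAlgebra α β φ)) : Subalgebra K (DownUpAlgebra α β φ) :=
  Algebra.adjoin K (S ∪ Set.range (t α β φ))

end Elements

/-- `x` is a root of unity. -/
def IsRootOfUnity {K : Type*} [Field K] (x : K) : Prop := ∃ k : ℕ, 0 < k ∧ x ^ k = 1

section Cases

variable {K : Type*} [Field K] {n : ℕ}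

/-- `x` is a primitive root of unity of order `m > 1`; the order `m = 1` is allowed if `φ = 0`. -/
def HasOrder (φ : MvPolynomial (Fin n) K) (x : K) (m : ℕ) : Prop :=
  IsPrimitiveRoot x m ∧ (1 < m ∨ (m = 1 ∧ φ = 0))

/-- `r = s` is a primitive root of unity of order `m`. -/
def CaseEqual (φ : MvPolynomial (Fin n) K) (r s : K) (m : ℕ) : Prop :=
  r = s ∧ HasOrder φ r m

/-- `(α, β) = (2, -1)` and `φ ≠ 0`. -/
def CaseUnipotent (φ : MvPolynomial (Fin n) K) (α β : K) : Prop :=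
  α = 2 ∧ β = -1 ∧ φ ≠ 0

/-- `x` is a primitive root of unity of order `m` and `y` is not a root of unity. -/
def CaseOneRoot (φ : MvPolynomial (Fin n) K) (x y : K) (m : ℕ) : Prop :=
  HasOrder φ x m ∧ ¬ IsRootOfUnity y

/-- `r ≠ s` and neither is a root of unity. -/
def CaseNoRoot (r s : K) : Prop :=
  r ≠ s ∧ ¬ IsRootOfUnity r ∧ ¬ IsRootOfUnity s

/-- `r ≠ s` are primitive roots of unity of orders `m₁` and `m₂`. -/
def CaseBothRoots (φ : MvPolynomial (Fin n) K) (r s : K) (m₁ m₂ : ℕ) : Prop :=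
  r ≠ s ∧ HasOrder φ r m₁ ∧ HasOrder φ s m₂

/-- `φ ≠ 0`, `x = 1`, and `y` is a primitive root of unity of order `m > 1`. -/
def CaseOneIsOne (φ : MvPolynomial (Fin n) K) (x y : K) (m : ℕ) : Prop :=
  φ ≠ 0 ∧ x = 1 ∧ IsPrimitiveRoot y m ∧ 1 < m

end Cases

end DownUp

namespace DownUp

/-! Work over `R = K[t₁, …, tₙ]`, which is central. The cubic relations make `ud` and `du` commute,
and say that passing `d` from the left to the right of a polynomial in `ud`, `du` applies the
substitution `σ : ud ↦ du`, `du ↦ (r + s) du - rs ud + φ`.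

If `r` and `s` are nonzero, `σ` is an automorphism of `B = R[X][Y]`, and the algebra is a
generalized Weyl algebra over `B`: every element is uniquely a sum of terms `b_k w_k`, where `w_k`
is `u ^ k` or `d ^ (-k)`. Uniqueness comes from a faithful enough action on sequences `ℤ → B`.
Commuting with `B` forces `σ ^ k = 1` whenever `b_k ≠ 0`, and commuting with `u` then forces `σ b_k
= b_k` (`IsWeyl.exists_of_mem_center`). The center is thus read off from the order of `σ` and its
invariants, in coordinates where `σ` has a normal form: - diagonal, `X ↦ sX`, `Y ↦ rY`, for `r ≠ s`
when both constants of `H` and `L` exist; invariants are spanned by the `X ^ i Y ^ j` with `s ^ i r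
^ j = 1`, and `σ ^ k = 1` gives the powers of `u` and `d`; - Jordan, `X ↦ sX`, `Y ↦ rY + γ X ^ e`
with `r = s ^ e` and `γ ≠ 0`, covering `r = s` (`e = 1`) and `r = 1 ≠ s`, `φ ≠ 0` (`e = 0`); in
characteristic zero the order is infinite and invariants involve only `X` (`fixed_of_jordan`); -
unipotent, `X ↦ X + φ`, `Y ↦ Y + X`, whose invariants are the polynomials in `X² - φX - 2φY`
(`exists_aeval_of_unipotent`).

If a root is `0`, `σ` is not invertible. Then the elements `u ^ i f(du) d ^ k` take the place of the
`b_k w_k`, and central elements reduce to polynomials `f(du)` with `f(rX + φ) = f`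
(`IsDownUp.exists_aeval_of_mem_center`).

Conversely, the listed generators commute with `u` and `d` by direct computation. -/

/-- The relations between the up and the down generator, written with the roots `r`, `s` of the
characteristic polynomial `x ^ 2 - α x - β`. -/
structure IsDownUpPair {R A : Type*} [CommRing R] [Ring A] [Algebra R A] (r s φ : R) (u d : A) :
    Prop where
  ddu : d * d * u = (r + s) • (d * u * d) - (r * s) • (u * d * d) + φ • d
  duu : d * u * u = (r + s) • (u * d * u) - (r * s) • (u * u * d) + φ • u

/-- `A` is generated over `R` by `u` and `d`, which satisfy the down-up relations and are universal
among the pairs of endomorphisms of an `R`-module that do. -/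
structure IsDownUp.{v, w} {R : Type v} {A : Type w} [CommRing R] [Ring A] [Algebra R A]
    (r s φ : R) (u d : A) : Prop extends IsDownUpPair r s φ u d where
  adjoin_eq_top : Algebra.adjoin R {u, d} = ⊤
  -- Only endomorphism rings in the universe of `R` are needed: the modules used later are sequences
  -- over `R[X][X]` and arrays over `R[X]`.
  exists_lift : ∀ (M : Type v) [AddCommGroup M] [Module R M] (U D : Module.End R M),
    IsDownUpPair r s φ U D → ∃ ρ : A →ₐ[R] Module.End R M, ρ u = U ∧ ρ d = D

/-! ### Weight elements and commutation of `ud` with `du` -/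

section Basic

variable {R A : Type*} [CommRing R] [Ring A] [Algebra R A] {r s φ : R} {u d : A}

theorem IsDownUpPair.symm (h : IsDownUpPair r s φ u d) : IsDownUpPair s r φ u d where
  ddu := by rw [add_comm s r, mul_comm s r]; exact h.ddu
  duu := by rw [add_comm s r, mul_comm s r]; exact h.duu

theorem IsDownUp.symm (h : IsDownUp r s φ u d) : IsDownUp s r φ u d where
  toIsDownUpPair := h.toIsDownUpPair.symm
  adjoin_eq_top := h.adjoin_eq_top
  exists_lift M _ _ U D hUD := h.exists_lift M U D hUD.symm

/-- Multiplying the first relation by `u` on the left and the second by `d` on the right produces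
the same right-hand side. -/
theorem IsDownUpPair.commute (h : IsDownUpPair r s φ u d) : Commute (u * d) (d * u) := by
  have h1 := congrArg (u * ·) h.ddu
  have h2 := congrArg (· * d) h.duu
  simp only [mul_add, mul_sub, add_mul, sub_mul, mul_smul_comm, smul_mul_assoc, ← mul_assoc]
    at h1 h2
  simp only [Commute, SemiconjBy, ← mul_assoc]
  rw [h1, h2]

/-- The element `du - r ud + c`. -/
def wt (r c : R) (u d : A) : A := d * u - r • (u * d) + algebraMap R A c

/-- The relation reads `d (du - r ud) = s (du - r ud) d + φ d`; a constant with `(s - 1) c = φ`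
absorbs the inhomogeneous term. Stating the condition without division also covers `s = 1`, `φ = 0`.
-/
theorem IsDownUpPair.d_mul_wt (h : IsDownUpPair r s φ u d) {c : R} (hc : (s - 1) * c = φ) :
    d * wt r c u d = s • (wt r c u d * d) := by
  have h1 := h.ddu
  simp only [wt, mul_add, mul_sub, add_mul, sub_mul, mul_smul_comm, smul_mul_assoc, ← mul_assoc,
    Algebra.algebraMap_eq_smul_one, mul_one, one_mul] at h1 ⊢
  rw [h1, ← hc]
  module

theorem IsDownUpPair.wt_mul_u (h : IsDownUpPair r s φ u d) {c : R} (hc : (s - 1) * c = φ) :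
    wt r c u d * u = s • (u * wt r c u d) := by
  have h1 := h.duu
  simp only [wt, mul_add, mul_sub, add_mul, sub_mul, mul_smul_comm, smul_mul_assoc, ← mul_assoc,
    Algebra.algebraMap_eq_smul_one, mul_one, one_mul] at h1 ⊢
  rw [h1, ← hc]
  module

theorem IsDownUpPair.commute_wt (h : IsDownUpPair r s φ u d) (a b c e : R) :
    Commute (wt a c u d) (wt b e u d) := by
  have h1 := h.commute
  have h2 : ∀ (x : R) (z : A), Commute (algebraMap R A x) z := Algebra.commutes
  have h3 : ∀ x (z : A), Commute z (algebraMap R A x) := fun x z => (h2 x z).symm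
  unfold wt
  refine Commute.add_left (Commute.sub_left ?_ ?_) (h2 _ _)
  · exact ((Commute.refl _).sub_right (h1.symm.smul_right _)).add_right (h3 _ _)
  · exact ((h1.smul_left _).sub_right (((Commute.refl _).smul_left _).smul_right _)).add_right
      (h3 _ _)

theorem mem_center_of_commute (h : IsDownUp r s φ u d) {z : A} (hu : Commute z u)
    (hd : Commute z d) : z ∈ Subalgebra.center R A := by
  rw [Subalgebra.mem_center_iff]
  intro a
  have ha : a ∈ Algebra.adjoin R {u, d} := by rw [h.adjoin_eq_top]; trivial
  have : Algebra.adjoin R {u, d} ≤ Subalgebra.centralizer R {z} := by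
    rw [Algebra.adjoin_le_iff]
    rintro y (rfl | rfl) <;> simp only [Subalgebra.coe_centralizer, Set.mem_centralizer_iff,
      Set.mem_singleton_iff, forall_eq]
    exacts [hu, hd]
  have := this ha
  rw [Subalgebra.mem_centralizer_iff] at this
  exact (this z rfl).symm

end Basic

/-! ### Generalized Weyl algebras: normal form -/

section Weyl

variable {R A B : Type*} [CommRing R] [Ring A] [Algebra R A] [CommRing B] [Algebra R B]

/-- The relations of a generalized Weyl algebra over `B` with automorphism `σ` and element `x`. -/
structure IsWeyl (σ : B ≃ₐ[R] B) (x : B) (ι : B →ₐ[R] A) (u d : A) : Prop where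
  ud : u * d = ι x
  du : d * u = ι (σ x)
  d_mul : ∀ b, d * ι b = ι (σ b) * d
  mul_u : ∀ b, ι b * u = u * ι (σ b)

/-- The monomial of degree `k` in `u`, `d`: `u ^ k` for `0 ≤ k` and `d ^ (-k)` for `k < 0`. -/
def word (u d : A) (k : ℤ) : A := u ^ k.toNat * d ^ (-k).toNat

theorem word_natCast (u d : A) (k : ℕ) : word u d k = u ^ k := by
  simp [word]

theorem word_neg_natCast (u d : A) (k : ℕ) : word u d (-k) = d ^ k := by
  simp [word]

namespace IsWeyl

variable {σ : B ≃ₐ[R] B} {x : B} {ι : B →ₐ[R] A} {u d : A}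

theorem u_mul (h : IsWeyl σ x ι u d) (b : B) : u * ι b = ι (σ⁻¹ b) * u := by
  rw [h.mul_u, AlgEquiv.aut_inv, AlgEquiv.apply_symm_apply]

theorem u_pow_mul (h : IsWeyl σ x ι u d) (k : ℕ) (b : B) :
    u ^ k * ι b = ι ((σ ^ (-k : ℤ)) b) * u ^ k := by
  induction k generalizing b with
  | zero => simp
  | succ k ih =>
    rw [pow_succ, mul_assoc, h.u_mul, ← mul_assoc, ih, mul_assoc, ← AlgEquiv.mul_apply,
      ← zpow_sub_one]
    congr 4
    push_cast; ring

theorem d_pow_mul (h : IsWeyl σ x ι u d) (k : ℕ) (b : B) :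
    d ^ k * ι b = ι ((σ ^ (k : ℤ)) b) * d ^ k := by
  induction k generalizing b with
  | zero => simp
  | succ k ih =>
    rw [pow_succ, mul_assoc, h.d_mul, ← mul_assoc, ih, mul_assoc, ← AlgEquiv.mul_apply,
      ← zpow_add_one]
    push_cast; rfl

theorem word_mul (h : IsWeyl σ x ι u d) (k : ℤ) (b : B) :
    word u d k * ι b = ι ((σ ^ (-k)) b) * word u d k := by
  obtain ⟨k, rfl | rfl⟩ := k.eq_nat_or_neg
  · rw [word_natCast, h.u_pow_mul]
  · rw [word_neg_natCast, h.d_pow_mul, neg_neg]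

/-- For negative `k` the last `d` meets `u`, and `du = ι (σ x)` is carried to the left through the
remaining `d ^ (-k - 1)`, which turns it into `σ ^ (-k) x`. -/
theorem word_mul_u (h : IsWeyl σ x ι u d) (k : ℤ) :
    word u d k * u = ι (if 0 ≤ k then 1 else (σ ^ (-k)) x) * word u d (k + 1) := by
  obtain ⟨k, rfl | rfl⟩ := k.eq_nat_or_neg
  · rw [word_natCast, if_pos (by positivity), ← Nat.cast_succ, word_natCast, pow_succ]; simp
  · cases k with
    | zero => simpa using by simp [word]
    | succ k =>
      rw [word_neg_natCast, if_neg (by push_cast; omega),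
        show (-((k + 1 : ℕ) : ℤ) + 1) = -(k : ℤ) by push_cast; ring, word_neg_natCast, pow_succ,
        mul_assoc, h.du, h.d_pow_mul, ← AlgEquiv.mul_apply, ← zpow_add_one]
      simp

theorem word_mul_d (h : IsWeyl σ x ι u d) (k : ℤ) :
    word u d k * d = ι (if k ≤ 0 then 1 else (σ ^ (1 - k)) x) * word u d (k - 1) := by
  obtain ⟨k, rfl | rfl⟩ := k.eq_nat_or_neg
  · cases k with
    | zero => simpa using by simp [word]
    | succ k =>
      rw [word_natCast, if_neg (by push_cast; omega),
        show (((k + 1 : ℕ) : ℤ) - 1) = (k : ℤ) by push_cast; ring, word_natCast, pow_succ,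
        mul_assoc, h.ud, h.u_pow_mul]
      congr 4
      push_cast; ring
  · rw [word_neg_natCast, if_pos (by omega), ← neg_add', ← Nat.cast_succ, word_neg_natCast,
      pow_succ]; simp

theorem u_mul_word (h : IsWeyl σ x ι u d) (k : ℤ) :
    u * word u d k = ι (if 0 ≤ k then 1 else x) * word u d (k + 1) := by
  obtain ⟨k, rfl | rfl⟩ := k.eq_nat_or_neg
  · rw [word_natCast, if_pos (by positivity), ← Nat.cast_succ, word_natCast, pow_succ']; simp
  · cases k with
    | zero => simpa using by simp [word]
    | succ k =>
      rw [word_neg_natCast, if_neg (by push_cast; omega),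
        show (-((k + 1 : ℕ) : ℤ) + 1) = -(k : ℤ) by push_cast; ring, word_neg_natCast, pow_succ',
        ← mul_assoc, h.ud]

/-- The element with coefficients `F` with respect to the monomials in `u` and `d`. -/
noncomputable def ofCoeff (ι : B →ₐ[R] A) (u d : A) (F : ℤ →₀ B) : A :=
  F.sum fun k b => ι b * word u d k

/-- The span of the `ι b * word u d k` contains `1` and is stable under right multiplication by `u`
and `d`, hence by everything. -/
theorem exists_ofCoeff (h : IsWeyl σ x ι u d) (hgen : Algebra.adjoin R {u, d} = ⊤) (a : A) :
    ∃ F, a = ofCoeff ι u d F := by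
  let T : ℤ → B →ₗ[R] A := fun k => (LinearMap.mulRight R (word u d k)) ∘ₗ ι.toLinearMap
  let Φ : (ℤ →₀ B) →ₗ[R] A := Finsupp.lsum R T
  have hΦ : ∀ F, Φ F = ofCoeff ι u d F := fun F => rfl
  have hmem : ∀ k b, ι b * word u d k ∈ LinearMap.range Φ := fun k b =>
    ⟨Finsupp.single k b, by simp [hΦ, ofCoeff]⟩
  have key : ∀ a, ∀ z ∈ LinearMap.range Φ, z * a ∈ LinearMap.range Φ := by
    have hstep : ∀ y : A, (∀ k b, ι b * word u d k * y ∈ LinearMap.range Φ) →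
        ∀ z ∈ LinearMap.range Φ, z * y ∈ LinearMap.range Φ := by
      rintro y hy _ ⟨F, rfl⟩
      rw [hΦ, ofCoeff, Finsupp.sum, Finset.sum_mul]
      exact Submodule.sum_mem _ fun k _ => hy _ _
    intro a
    have ha : a ∈ Algebra.adjoin R {u, d} := by rw [hgen]; trivial
    induction ha using Algebra.adjoin_induction with
    | mem y hy =>
      apply hstep
      intro k b
      obtain rfl | rfl := hy
      · rw [mul_assoc, h.word_mul_u, ← mul_assoc, ← map_mul]; exact hmem _ _
      · rw [mul_assoc, h.word_mul_d, ← mul_assoc, ← map_mul]; exact hmem _ _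
    | algebraMap c =>
      intro z hz
      rw [← Algebra.commutes, ← Algebra.smul_def]
      exact Submodule.smul_mem _ _ hz
    | add y y' _ _ hy hy' =>
      intro z hz
      rw [mul_add]
      exact add_mem (hy z hz) (hy' z hz)
    | mul y y' _ _ hy hy' =>
      intro z hz
      rw [← mul_assoc]
      exact hy' _ (hy _ hz)
  obtain ⟨F, hF⟩ := key a 1 (by simpa [word] using hmem 0 1)
  exact ⟨F, by rw [← hΦ, hF, one_mul]⟩

end IsWeyl

end Weyl


/-! ### The action of a generalized Weyl algebra on sequences -/

section Model

variable {R : Type*} [CommRing R] {B : Type*} [CommRing B] [Algebra R B]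

/-- The shift of bi-infinite sequences, by which `u` acts on the weight module of a generalized
Weyl algebra. -/
def seqU (R B : Type*) [CommRing R] [CommRing B] [Algebra R B] : Module.End R (ℤ → B) where
  toFun f i := f (i - 1)
  map_add' _ _ := rfl
  map_smul' _ _ := rfl

/-- The weighted backward shift of bi-infinite sequences, by which `d` acts on the weight module of
a generalized Weyl algebra. -/
def seqD (σ : B ≃ₐ[R] B) (x : B) : Module.End R (ℤ → B) where
  toFun f i := (σ ^ (i + 1)) x * f (i + 1)
  map_add' f g := by ext i; simp [mul_add]
  map_smul' c f := by ext i; simp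

/-- The diagonal action of `B` on bi-infinite sequences. -/
def seqDiag (σ : B ≃ₐ[R] B) : B →ₐ[R] Module.End R (ℤ → B) where
  toFun b :=
    { toFun := fun f i => (σ ^ i) b * f i
      map_add' := fun f g => by ext i; simp [mul_add]
      map_smul' := fun c f => by ext i; simp }
  map_one' := by ext f i; simp
  map_mul' a b := by ext f i; simp [mul_assoc]
  map_zero' := by ext f i; simp
  map_add' a b := by ext f i; simp [add_mul]
  commutes' c := by ext f i; simp [Algebra.smul_def]

theorem seqU_apply (f : ℤ → B) (i : ℤ) : seqU R B f i = f (i - 1) := rfl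

theorem seqD_apply (σ : B ≃ₐ[R] B) (x : B) (f : ℤ → B) (i : ℤ) :
    seqD σ x f i = (σ ^ (i + 1)) x * f (i + 1) := rfl

theorem seqDiag_apply (σ : B ≃ₐ[R] B) (b : B) (f : ℤ → B) (i : ℤ) :
    seqDiag σ b f i = (σ ^ i) b * f i := rfl

theorem seqU_pow_apply (k : ℕ) (f : ℤ → B) (i : ℤ) : (seqU R B ^ k) f i = f (i - k) := by
  induction k generalizing f with
  | zero => simp
  | succ k ih =>
    rw [pow_succ, Module.End.mul_apply, ih, seqU_apply]; congr 1; push_cast; ring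

theorem seqD_pow_apply (σ : B ≃ₐ[R] B) (x : B) (k : ℕ) (f : ℤ → B) (i : ℤ) :
    (seqD σ x ^ k) f i = (∏ l ∈ Finset.range k, (σ ^ (i + l + 1)) x) * f (i + k) := by
  induction k generalizing f with
  | zero => simp
  | succ k ih =>
    rw [pow_succ, Module.End.mul_apply, ih, seqD_apply, Finset.prod_range_succ, mul_assoc]
    push_cast; simp only [add_assoc]

/-- Both relations amount to the second-order recurrence for `i ↦ σ ^ i x`, obtained by applying `σ
^ i` to `hx`. -/
theorem isDownUpPair_seq {σ : B ≃ₐ[R] B} {x : B} {r s φ : R}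
    (hx : σ (σ x) = (r + s) • σ x - (r * s) • x + algebraMap R B φ) :
    IsDownUpPair r s φ (seqU R B) (seqD σ x) := by
  have hx' : ∀ i : ℤ, (σ ^ (i + 1 + 1)) x =
      (r + s) • (σ ^ (i + 1)) x - (r * s) • (σ ^ i) x + algebraMap R B φ := fun i => by
    have := congrArg (σ ^ i) hx
    rw [map_add, map_sub, map_smul, map_smul, AlgEquiv.commutes] at this
    simpa only [← AlgEquiv.mul_apply, ← zpow_add_one, ← mul_assoc] using this
  constructor
  · ext f i
    simp only [Module.End.mul_apply, seqU_apply, seqD_apply, LinearMap.add_apply,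
      LinearMap.sub_apply, LinearMap.smul_apply, Pi.add_apply, Pi.sub_apply, Pi.smul_apply,
      sub_add_cancel, add_sub_cancel_right, hx']
    simp only [Algebra.smul_def]
    ring
  · ext f i
    have := hx' (i - 1)
    rw [sub_add_cancel] at this
    simp only [Module.End.mul_apply, seqU_apply, seqD_apply, LinearMap.add_apply,
      LinearMap.sub_apply, LinearMap.smul_apply, Pi.add_apply, Pi.sub_apply, Pi.smul_apply,
      sub_add_cancel, add_sub_cancel_right, this]
    simp only [Algebra.smul_def]
    ring

end Model

/-- The relations of a generalized Weyl algebra need only be checked on generators of `B`. -/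
theorem IsDownUpPair.isWeyl {R A B : Type*} [CommRing R] [Ring A] [Algebra R A] [CommRing B]
    [Algebra R B] {r s φ : R} {u d : A} (h : IsDownUpPair r s φ u d) {σ : B ≃ₐ[R] B} {x : B}
    {ι : B →ₐ[R] A} (hx : σ (σ x) = (r + s) • σ x - (r * s) • x + algebraMap R B φ)
    (hgen : Algebra.adjoin R {x, σ x} = ⊤) (hud : ι x = u * d) (hdu : ι (σ x) = d * u) :
    IsWeyl σ x ι u d where
  ud := hud.symm
  du := hdu.symm
  d_mul b := by
    have hb : b ∈ Algebra.adjoin R {x, σ x} := by rw [hgen]; trivial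
    induction hb using Algebra.adjoin_induction with
    | mem y hy =>
      obtain rfl | rfl := hy
      · rw [hud, hdu, mul_assoc]
      · rw [hx, map_add, map_sub, map_smul, map_smul, hud, hdu, AlgHom.commutes, ← mul_assoc,
          h.ddu]
        simp only [Algebra.algebraMap_eq_smul_one, add_mul, sub_mul, smul_mul_assoc, one_mul]
    | algebraMap c => simp only [AlgHom.commutes, AlgEquiv.commutes, Algebra.commutes]
    | add y z _ _ hy hz => simp only [map_add, mul_add, add_mul, hy, hz]
    | mul y z _ _ hy hz => simp only [map_mul]; rw [← mul_assoc, hy, mul_assoc, hz, mul_assoc]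
  mul_u b := by
    have hb : b ∈ Algebra.adjoin R {x, σ x} := by rw [hgen]; trivial
    induction hb using Algebra.adjoin_induction with
    | mem y hy =>
      obtain rfl | rfl := hy
      · rw [hud, hdu, mul_assoc]
      · rw [hx, map_add, map_sub, map_smul, map_smul, hud, hdu, AlgHom.commutes, h.duu]
        simp only [Algebra.algebraMap_eq_smul_one, mul_add, mul_sub, mul_smul_comm, mul_one,
          mul_assoc]
    | algebraMap c => simp only [AlgHom.commutes, AlgEquiv.commutes, Algebra.commutes]
    | add y z _ _ hy hz => simp only [map_add, mul_add, add_mul, hy, hz]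
    | mul y z _ _ hy hz => simp only [map_mul]; rw [mul_assoc, hz, ← mul_assoc, hy, mul_assoc]

/-! ### Coefficients and the center of a generalized Weyl algebra -/

namespace IsWeyl

universe v w

variable {R B : Type v} {A : Type w} [CommRing R] [Ring A] [Algebra R A] [CommRing B] [Algebra R B]
  {σ : B ≃ₐ[R] B} {x : B} {ι : B →ₐ[R] A} {u d : A} {r s φ : R}

/-- The coefficients with respect to the monomials in `u` and `d`, up to nonzero factors. -/
theorem exists_coeff [IsDomain B] (hW : IsWeyl σ x ι u d) (h : IsDownUp r s φ u d)
    (hx : σ (σ x) = (r + s) • σ x - (r * s) • x + algebraMap R B φ)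
    (hgen : Algebra.adjoin R {x, σ x} = ⊤) (hx0 : x ≠ 0) :
    ∃ (κ : ℤ → A →ₗ[R] B) (c : ℤ → B), (∀ k, c k ≠ 0) ∧
      ∀ j k b, κ k (ι b * word u d j) = if j = k then b * c k else 0 := by
  obtain ⟨ρ, hρu, hρd⟩ := h.exists_lift (ℤ → B) (seqU R B) (seqD σ x) (isDownUpPair_seq hx)
  have hρι : ∀ b, ρ (ι b) = seqDiag σ b := by
    intro b
    have hb : b ∈ Algebra.adjoin R {x, σ x} := by rw [hgen]; trivial
    have : Algebra.adjoin R {x, σ x} ≤ AlgHom.equalizer (ρ.comp ι) (seqDiag σ) := by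
      rw [Algebra.adjoin_le_iff]
      rintro y (rfl | rfl)
      · change ρ (ι y) = seqDiag σ y
        rw [← hW.ud, map_mul, hρu, hρd]
        ext f i
        simp [seqU_apply, seqD_apply, seqDiag_apply]
      · change ρ (ι (σ x)) = seqDiag σ (σ x)
        rw [← hW.du, map_mul, hρu, hρd]
        ext f i
        simp [seqU_apply, seqD_apply, seqDiag_apply, zpow_add_one, AlgEquiv.mul_apply]
    exact this hb
  -- Apply `a` to the delta sequence at `-k` and read entry `0`: `word u d j` shifts by `j`, so only
  -- `j = k` contributes. For `k < 0` the shift by `d ^ (-k)` carries a product of translates of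
  -- `x`, nonzero since `B` is a domain; for `k ≥ 0` the product is empty.
  refine ⟨fun k => (LinearMap.proj 0 ∘ₗ LinearMap.applyₗ (Pi.single (-k) 1 : ℤ → B)) ∘ₗ
    ρ.toLinearMap, fun k => ∏ l ∈ Finset.range (-k).toNat, (σ ^ (0 + l + 1 : ℤ)) x, fun k => ?_,
    fun j k b => ?_⟩
  · exact Finset.prod_ne_zero_iff.2 fun l _ => by simpa using hx0
  · simp only [LinearMap.comp_apply, AlgHom.toLinearMap_apply, LinearMap.applyₗ_apply_apply,
      LinearMap.proj_apply, map_mul, hρι, Module.End.mul_apply, seqDiag_apply, word, map_pow, hρu,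
      hρd, seqU_pow_apply, seqD_pow_apply, zpow_zero, AlgEquiv.one_apply, Pi.single_apply]
    obtain ⟨j, rfl | rfl⟩ := j.eq_nat_or_neg
    · by_cases hjk : (j : ℤ) = k
      · subst hjk; simp
      · rw [if_neg hjk, if_neg (by simpa using hjk)]; simp
    · by_cases hjk : -(j : ℤ) = k
      · subst hjk; simp
      · rw [if_neg hjk, if_neg (by simp; omega)]; simp

theorem exists_of_mem_center [IsDomain B] (hW : IsWeyl σ x ι u d) (h : IsDownUp r s φ u d)
    (hx : σ (σ x) = (r + s) • σ x - (r * s) • x + algebraMap R B φ)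
    (hgen : Algebra.adjoin R {x, σ x} = ⊤) (hx0 : x ≠ 0) {z : A}
    (hz : z ∈ Subalgebra.center R A) :
    ∃ F : ℤ →₀ B, z = ofCoeff ι u d F ∧ ∀ k, σ (F k) = F k ∧ (F k ≠ 0 → σ ^ k = 1) := by
  obtain ⟨κ, c, hc, hκ⟩ := hW.exists_coeff h hx hgen hx0
  obtain ⟨F, rfl⟩ := hW.exists_ofCoeff h.adjoin_eq_top z
  rw [Subalgebra.mem_center_iff] at hz
  have hσ : ∀ k, F k ≠ 0 → σ ^ k = 1 := by
    intro k hk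
    -- The coefficients at `k` of `ι b * z = z * ι b` give `b * F k = F k * σ ^ (-k) b`, and `F k`
    -- cancels.
    have key : ∀ b, (σ ^ (-k)) b = b := by
      intro b
      have h1 := congrArg (κ k) (hz (ι b))
      simp only [ofCoeff, Finsupp.sum, Finset.mul_sum, Finset.sum_mul, map_sum, mul_assoc,
        hW.word_mul] at h1
      simp only [← mul_assoc, ← map_mul, hκ, Finset.sum_ite_eq', Finsupp.mem_support_iff, ne_eq,
        hk, not_false_eq_true, if_true] at h1
      have h2 := mul_right_cancel₀ (hc k) h1
      rw [mul_comm] at h2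
      exact (mul_left_cancel₀ hk h2).symm
    have : σ ^ (-k) = 1 := by ext b; exact key b
    rwa [zpow_neg, inv_eq_one] at this
  refine ⟨F, rfl, fun k => ⟨?_, hσ k⟩⟩
  by_cases hk : F k = 0
  · simp [hk]
  -- In degree `k + 1`, `z * u = u * z` compares `F k` with `σ⁻¹ (F k)`, up to a factor that is `1`
  -- for `k ≥ 0` and otherwise `σ ^ (-k) x` against `x`. These agree because `σ ^ k = 1`.
  have h1 := congrArg (κ (k + 1)) (hz u)
  simp only [ofCoeff, Finsupp.sum, Finset.mul_sum, Finset.sum_mul, map_sum, mul_assoc,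
    hW.word_mul_u] at h1
  simp only [← mul_assoc, hW.u_mul] at h1
  simp only [mul_assoc, hW.u_mul_word] at h1
  simp only [← mul_assoc, ← map_mul, hκ, Finset.sum_ite_eq', Finsupp.mem_support_iff, ne_eq,
    hk, not_false_eq_true, if_true, add_left_inj] at h1
  have h2 := mul_right_cancel₀ (hc (k + 1)) h1
  rw [zpow_neg, hσ k hk, inv_one, AlgEquiv.one_apply] at h2
  have h3 := mul_right_cancel₀ (by split_ifs <;> simp [hx0]) h2
  conv_lhs => rw [← h3]
  rw [← AlgEquiv.mul_apply, mul_inv_cancel, AlgEquiv.one_apply]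

/-- If `σ` has infinite order, then the center consists of the fixed elements of `B`. -/
theorem exists_fixed_of_mem_center [IsDomain B] (hW : IsWeyl σ x ι u d) (h : IsDownUp r s φ u d)
    (hx : σ (σ x) = (r + s) • σ x - (r * s) • x + algebraMap R B φ)
    (hgen : Algebra.adjoin R {x, σ x} = ⊤) (hx0 : x ≠ 0) (hσ : ∀ k : ℕ, 0 < k → σ ^ k ≠ 1) {z : A}
    (hz : z ∈ Subalgebra.center R A) : ∃ b, z = ι b ∧ σ b = b := by
  obtain ⟨F, rfl, hF⟩ := hW.exists_of_mem_center h hx hgen hx0 hz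
  refine ⟨F 0, ?_, (hF 0).1⟩
  have h0 : ∀ k, k ≠ 0 → F k = 0 := by
    intro k hk
    by_contra hFk
    have h1 := (hF k).2 hFk
    refine hσ k.natAbs (by omega) ?_
    obtain ⟨m, rfl | rfl⟩ := k.eq_nat_or_neg
    · simpa using h1
    · simpa using h1
  rw [ofCoeff, Finsupp.sum_eq_single 0 (fun k _ hk => by rw [h0 k hk]; simp) (by simp)]
  simp [word]

end IsWeyl

open Polynomial

/-! ### Polynomials under translation and composition -/

section Coeff

variable {D : Type*} [CommRing D]

/-- Only the terms of degree `N` and `N + 1` reach the coefficient of `X ^ N`; the second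
contributes its binomial coefficient `N + 1`. -/
theorem coeff_comp_X_add_C {f : D[X]} {N : ℕ} (hf : f.natDegree ≤ N + 1) (b : D) :
    (f.comp (X + C b)).coeff N = f.coeff N + (N + 1) * f.coeff (N + 1) * b := by
  have h0 : ∀ j ∈ Finset.range N, (C (f.coeff j) * (X + C b) ^ j).coeff N = 0 := by
    intro j hj
    rw [coeff_C_mul, coeff_X_add_C_pow, Nat.choose_eq_zero_of_lt (Finset.mem_range.1 hj)]
    simp
  rw [comp, eval₂_eq_sum_range' C (Nat.lt_succ_of_le hf), finsetSum_coeff, Finset.sum_range_succ,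
    Finset.sum_range_succ, Finset.sum_eq_zero h0, coeff_C_mul, coeff_C_mul, coeff_X_add_C_pow,
    coeff_X_add_C_pow]
  simp
  ring

theorem coeff_succ_comp_X_add_C {f : D[X]} {N : ℕ} (hf : f.natDegree ≤ N) (b : D) :
    (f.comp (X + C b)).coeff N = f.coeff N := by
  rw [coeff_comp_X_add_C (hf.trans N.le_succ), coeff_eq_zero_of_natDegree_lt (n := N + 1) (by omega)]
  simp

/-- A translation changes the coefficient just below the leading one by degree times leading
coefficient times `b`, nonzero in characteristic zero. -/
theorem natDegree_eq_zero_of_comp_X_add_C [IsDomain D] [CharZero D] {f : D[X]} {b : D}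
    (hb : b ≠ 0) (hf : f.comp (X + C b) = f) : f.natDegree = 0 := by
  by_contra h0
  obtain ⟨N, hN⟩ := Nat.exists_eq_succ_of_ne_zero h0
  have h1 := coeff_comp_X_add_C (f := f) (N := N) hN.le b
  rw [hf, left_eq_add] at h1
  have h2 : f.coeff (N + 1) ≠ 0 := by
    rw [← Nat.succ_eq_add_one, ← hN]
    exact leadingCoeff_ne_zero.2 fun h => h0 (by simp [h])
  have h3 : ((N : D) + 1) ≠ 0 := by exact_mod_cast Nat.succ_ne_zero N
  simp [h2, h3, hb] at h1

theorem comp_linear (f : D[X]) (a b : D) :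
    f.comp (C a * X + C b) = (f.comp (X + C b)).comp (C a * X) := by
  rw [comp_assoc]; simp

/-- A polynomial whose composition with a monic polynomial is divisible by `c` is divisible
by `c`. -/
theorem exists_eq_C_mul_of_comp [IsDomain D] {m : D[X]} (hm : m.Monic) (hm0 : m.natDegree ≠ 0)
    (c : D) : ∀ h p : D[X], h.comp m = C c * p → ∃ g, h = C c * g := by
  intro h
  induction hN : h.natDegree using Nat.strong_induction_on generalizing h with
  | _ N ih =>
    intro p hp
    -- As `m` is monic, `h` and `h.comp m` share their leading coefficient, so `c` divides that of
    -- `h`; removing the leading term keeps the hypothesis.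
    have h1 : h.leadingCoeff = c * p.coeff (h.natDegree * m.natDegree) := by
      rw [← coeff_C_mul, ← hp, coeff_comp_degree_mul_degree hm0, hm.leadingCoeff, one_pow, mul_one]
    have h2 := h.eraseLead_add_C_mul_X_pow
    by_cases h0 : h.natDegree = 0
    · refine ⟨C (p.coeff (h.natDegree * m.natDegree)), ?_⟩
      rw [← C_mul, ← h1, leadingCoeff, h0]
      exact eq_C_of_natDegree_eq_zero h0
    · have h3 : h.eraseLead.natDegree < N := by
        have := h.eraseLead_natDegree_le
        omega
      obtain ⟨g, hg⟩ := ih _ h3 _ rfl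
        (p - C (p.coeff (h.natDegree * m.natDegree)) * m ^ h.natDegree) (by
          have h4 := congrArg (fun q => q.comp m) h2
          simp only [add_comp, mul_comp, C_comp, pow_comp, X_comp] at h4
          rw [mul_sub, ← hp, ← h4, h1, C_mul]
          ring)
      refine ⟨g + C (p.coeff (h.natDegree * m.natDegree)) * X ^ h.natDegree, ?_⟩
      rw [mul_add, ← hg, ← mul_assoc, ← C_mul, ← h1, h2]

end Coeff

/-! ### Triangular automorphisms of `R[X][Y]` -/

section Tri

variable {R : Type*} [CommRing R]

/-- The endomorphism of `R[X][Y]` that sends `X` to `s X + c` and `Y` to `r Y + g(X)`. -/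
noncomputable def triHom (s c r : R) (g : R[X]) : R[X][X] →ₐ[R] R[X][X] :=
  aevalAeval (C (C s * X + C c)) (C (C r) * X + C g)

theorem triHom_X (s c r : R) (g : R[X]) : triHom s c r g (C X) = C (C s * X + C c) :=
  aevalAeval_X _ _

theorem triHom_Y (s c r : R) (g : R[X]) : triHom s c r g X = C (C r) * X + C g :=
  aevalAeval_Y _ _

theorem triHom_C (s c r : R) (g p : R[X]) :
    triHom s c r g (C p) = C (p.comp (C s * X + C c)) := by
  rw [triHom, aevalAeval_C, comp_eq_aeval, ← algebraMap_eq (R := R[X]), aeval_algebraMap_apply]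

theorem triHom_apply (s c r : R) (g : R[X]) (f : R[X][X]) :
    triHom s c r g f =
      (f.map (compRingHom (C s * X + C c))).comp (C (C r) * X + C g) := by
  induction f using Polynomial.induction_on' with
  | add p q hp hq => simp only [map_add, hp, hq, Polynomial.map_add, add_comp]
  | monomial n p =>
    rw [← C_mul_X_pow_eq_monomial, map_mul, map_pow, triHom_C, triHom_Y]
    simp

theorem algHom_ext_XY {S : Type*} [Semiring S] [Algebra R S] {f g : R[X][X] →ₐ[R] S}
    (hX : f (C X) = g (C X)) (hY : f X = g X) : f = g := by
  ext <;> simpa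

/-- The automorphism of `R[X][Y]` that sends `X` to `s X + c` and `Y` to `r Y + g(X)`. -/
noncomputable def triEquiv (s r : Rˣ) (c : R) (g : R[X]) : R[X][X] ≃ₐ[R] R[X][X] :=
  AlgEquiv.ofAlgHom (triHom (s : R) c (r : R) g)
    -- The inverse solves the triangular system: `X ↦ s⁻¹ (X - c)`, `Y ↦ r⁻¹ (Y - g(s⁻¹ (X - c)))`.
    (triHom (↑s⁻¹ : R) (-(↑s⁻¹ * c)) (↑r⁻¹ : R)
      (-(C (↑r⁻¹ : R) * g.comp (C (↑s⁻¹ : R) * X + C (-(↑s⁻¹ * c))))))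
    (by
      have hs : C (C (↑s⁻¹ : R)) * C (C (s : R)) = (1 : R[X][X]) := by simp [← C_mul]
      have hr : C (C (↑r⁻¹ : R)) * C (C (r : R)) = (1 : R[X][X]) := by simp [← C_mul]
      apply algHom_ext_XY
      · simp only [AlgHom.comp_apply, triHom_C, AlgHom.id_apply]
        simp only [mul_comp, add_comp, neg_comp, C_comp, X_comp, map_add, map_mul, map_neg]
        linear_combination C X * hs
      · simp only [AlgHom.comp_apply, triHom_Y, triHom_C, AlgHom.id_apply, map_add, map_mul,
          neg_comp, mul_comp, C_comp, comp_assoc, add_comp, X_comp]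
        rw [show (C (↑s⁻¹ : R) * (C (s : R) * X + C c) + C (-(↑s⁻¹ * c)) : R[X]) = X by
          rw [mul_add, ← mul_assoc, ← C_mul, ← C_mul, Units.inv_mul, C_1, C_neg]; ring, comp_X]
        simp only [map_neg, map_mul]
        linear_combination X * hr)
    (by
      have hs : C (C (↑s⁻¹ : R)) * C (C (s : R)) = (1 : R[X][X]) := by simp [← C_mul]
      have hr : C (C (↑r⁻¹ : R)) * C (C (r : R)) = (1 : R[X][X]) := by simp [← C_mul]
      apply algHom_ext_XY
      · simp only [AlgHom.comp_apply, triHom_C, AlgHom.id_apply]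
        simp only [mul_comp, add_comp, C_comp, X_comp, map_add, map_mul, map_neg]
        linear_combination (C X - C (C c)) * hs
      · simp only [AlgHom.comp_apply, triHom_Y, triHom_C, AlgHom.id_apply, map_add, map_mul,
          C_comp]
        generalize g.comp (C (↑s⁻¹ : R) * X + C (-(↑s⁻¹ * c))) = g'
        simp only [map_neg, map_mul]
        linear_combination (X - C g') * hr)

theorem triEquiv_apply (s r : Rˣ) (c : R) (g : R[X]) (f : R[X][X]) :
    triEquiv s r c g f = triHom (s : R) c (r : R) g f := rfl

theorem adjoin_X_Y : Algebra.adjoin R {C X, (X : R[X][X])} = ⊤ := by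
  rw [eq_top_iff]
  rintro f -
  have hX : (C X : R[X][X]) ∈ Algebra.adjoin R {C X, (X : R[X][X])} :=
    Algebra.subset_adjoin (by simp)
  have hY : (X : R[X][X]) ∈ Algebra.adjoin R {C X, (X : R[X][X])} :=
    Algebra.subset_adjoin (by simp)
  induction f using Polynomial.induction_on' with
  | add p q hp hq => exact add_mem hp hq
  | monomial n p =>
    rw [← C_mul_X_pow_eq_monomial]
    refine mul_mem ?_ (pow_mem hY n)
    induction p using Polynomial.induction_on' with
    | add p q hp hq => rw [C_add]; exact add_mem hp hq
    | monomial m a =>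
      rw [← C_mul_X_pow_eq_monomial, C_mul, C_pow]
      exact mul_mem (Subalgebra.algebraMap_mem _ a) (pow_mem hX m)

/-- The evaluation of bivariate polynomials at a commuting pair. -/
theorem exists_algHom_of_commute {A : Type*} [Ring A] [Algebra R A] {p q : A} (h : Commute p q) :
    ∃ ι : R[X][X] →ₐ[R] A, ι (C X) = p ∧ ι X = q := by
  have hc : ∀ a : R[X], Commute ((aeval p : R[X] →ₐ[R] A) a) q := by
    intro a
    induction a using Polynomial.induction_on' with
    | add a b ha hb => rw [map_add]; exact ha.add_left hb
    | monomial n a =>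
      rw [aeval_monomial]
      exact Commute.mul_left (Algebra.commutes a q) (h.pow_left n)
  let e := eval₂RingHom' (aeval p : R[X] →ₐ[R] A).toRingHom q hc
  refine ⟨{ e with commutes' := fun a => ?_ }, ?_, ?_⟩
  · change eval₂ _ _ (C (C a)) = _
    simp [eval₂_C]
  · change eval₂ _ _ (C X) = _
    simp [eval₂_C]
  · change eval₂ _ _ X = _
    simp

theorem algHom_apply_mem {A : Type*} [Ring A] [Algebra R A] (ι : R[X][X] →ₐ[R] A)
    (S : Submodule R A) (f : R[X][X])
    (h : ∀ i j, (f.coeff j).coeff i ≠ 0 → ι (C X) ^ i * ι X ^ j ∈ S) : ι f ∈ S := by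
  rw [f.as_sum_range_C_mul_X_pow, map_sum]
  refine Submodule.sum_mem _ fun j _ => ?_
  conv in C (f.coeff j) => rw [(f.coeff j).as_sum_range_C_mul_X_pow]
  rw [map_sum, Finset.sum_mul, map_sum]
  refine Submodule.sum_mem _ fun i _ => ?_
  by_cases hij : (f.coeff j).coeff i = 0
  · simp [hij]
  · have := S.smul_mem ((f.coeff j).coeff i) (h i j hij)
    have hC : C (C ((f.coeff j).coeff i)) = algebraMap R R[X][X] ((f.coeff j).coeff i) := rfl
    rw [C_mul, C_pow, hC, map_mul, map_mul, map_pow, map_pow, AlgHom.commutes]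
    rwa [Algebra.smul_def, ← mul_assoc] at this

end Tri

/-! ### Invariants of the normal forms -/

section Fixed

variable {R : Type*} [CommRing R] [IsDomain R]

theorem pow_mul_pow_eq_one_of_fixed {s r : R} {f : R[X][X]} (hf : triHom s 0 r 0 f = f) {i j : ℕ}
    (hij : (f.coeff j).coeff i ≠ 0) : s ^ i * r ^ j = 1 := by
  have h := congrArg (fun f => (f.coeff j).coeff i) hf
  rw [triHom_apply] at h
  simp only [map_zero, add_zero, comp_C_mul_X_coeff, coeff_map, coe_compRingHom_apply,
    ← C_pow, coeff_mul_C] at h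
  rw [mul_assoc] at h
  exact mul_left_cancel₀ hij (by rw [h, mul_one])

/-- The top coefficient in `Y` is only scaled, so a monomial `X ^ l` in it satisfies `s ^ l r ^ (N +
1) = 1`, where `N + 1` is the `Y`-degree, if positive. Since `r = s ^ e`, the monomial `X ^ (l + e)
Y ^ N` is also scaled by `1`, but it receives in addition `(N + 1) γ s ^ l r ^ N` times the top
coefficient. This is nonzero in characteristic zero, so the `Y`-degree is `0`. -/
theorem fixed_of_jordan [CharZero R] {s r γ : R} {e : ℕ} (hr : r = s ^ e) (hr0 : r ≠ 0)
    (hγ : γ ≠ 0) {f : R[X][X]} (hf : triHom s 0 r (C γ * X ^ e) f = f) {i j : ℕ}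
    (hij : (f.coeff j).coeff i ≠ 0) : j = 0 ∧ s ^ i = 1 := by
  have hcoeff : ∀ k l, ((triHom s 0 r (C γ * X ^ e) f).coeff k).coeff l =
      ((((f.map (compRingHom (C s * X))).comp (X + C (C γ * X ^ e))).coeff k).coeff l) *
        r ^ k := by
    intro k l
    rw [triHom_apply, comp_linear, comp_C_mul_X_coeff, ← C_pow, coeff_mul_C]
    simp
  have hdeg : (f.map (compRingHom (C s * X))).natDegree ≤ f.natDegree := natDegree_map_le
  have hmap : ∀ k l, ((f.map (compRingHom (C s * X))).coeff k).coeff l =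
      (f.coeff k).coeff l * s ^ l := by
    intro k l
    rw [coeff_map, coe_compRingHom_apply, comp_C_mul_X_coeff]
  have hlead : ∀ l, (f.coeff f.natDegree).coeff l ≠ 0 → s ^ l * r ^ f.natDegree = 1 := by
    intro l hl
    have h := hcoeff f.natDegree l
    rw [hf, coeff_succ_comp_X_add_C hdeg, hmap, mul_assoc] at h
    exact mul_left_cancel₀ hl (by rw [← h, mul_one])
  have h0 : f.natDegree = 0 := by
    by_contra h0
    obtain ⟨N, hN⟩ := Nat.exists_eq_succ_of_ne_zero h0
    obtain ⟨l, hl⟩ : ∃ l, (f.coeff f.natDegree).coeff l ≠ 0 := by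
      by_contra! hl
      have : f.leadingCoeff = 0 := Polynomial.ext hl
      rw [leadingCoeff_eq_zero] at this
      exact h0 (by simp [this])
    have h1 := hlead l hl
    have h2 := hcoeff N (l + e)
    have h3 : s ^ (l + e) * r ^ N = 1 := by
      rw [← h1, hN, Nat.succ_eq_add_one, pow_succ, pow_add, hr]; ring
    rw [hf, coeff_comp_X_add_C (hdeg.trans hN.le), coeff_add, hmap, ← mul_assoc, coeff_mul_X_pow,
      coeff_mul_C, ← Nat.cast_succ, ← C_eq_natCast, coeff_C_mul, hmap, add_mul, mul_assoc _ _ (r ^ N),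
      h3, mul_one, left_eq_add, ← Nat.succ_eq_add_one, ← hN] at h2
    have hs : s ^ l ≠ 0 := left_ne_zero_of_mul_eq_one h1
    have hN0 : ((f.natDegree : ℕ) : R) ≠ 0 := Nat.cast_ne_zero.2 h0
    simp only [mul_eq_zero, pow_eq_zero_iff', hN0, hl, hγ, hr0, hs, or_false, false_and] at h2
  have hj : j = 0 := by
    by_contra hj
    rw [coeff_eq_zero_of_natDegree_lt (p := f) (by omega)] at hij
    simp at hij
  subst hj
  have := hlead i (by rwa [h0])
  rw [h0] at this
  exact ⟨rfl, by simpa using this⟩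

/-- The invariants of the automorphism `X ↦ X + φ`, `Y ↦ Y + X`. -/
theorem exists_aeval_of_unipotent [CharZero R] {φ : R} (hφ : φ ≠ 0) {f : R[X][X]}
    (hf : triHom 1 φ 1 X f = f) :
    ∃ h : R[X], f = aeval (C (X ^ 2 - C φ * X) - C (C (2 * φ)) * X : R[X][X]) h := by
  set m : R[X] := X ^ 2 - C φ * X with hm
  set Ω : R[X][X] := C m - C (C (2 * φ)) * X with hΩ
  have h2φ : (2 * φ) ≠ 0 := mul_ne_zero two_ne_zero hφ
  have hmm : m.Monic := by rw [hm]; monicity!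
  have hmdeg : m.natDegree = 2 := by rw [hm]; compute_degree!
  have hΩdeg : Ω.natDegree ≠ 0 := by
    have : Ω.natDegree = 1 := by
      have h : -C (2 * φ) ≠ (0 : R[X]) := by simpa using hφ
      rw [hΩ, show C m - C (C (2 * φ)) * X = C (-C (2 * φ)) * X + C m by rw [C_neg]; ring]
      exact natDegree_linear h
    omega
  have hΩσ : triHom 1 φ 1 X Ω = Ω := by
    rw [hΩ, map_sub, map_mul, triHom_C, triHom_C, triHom_Y, hm]
    simp only [sub_comp, pow_comp, mul_comp, C_comp, X_comp]
    simp only [C_sub, C_add, C_mul, C_pow, C_1, two_mul]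
    ring
  -- Since `φ` need not be invertible in `R`, `Y` is eliminated through `2φ Y = m - Ω` only after
  -- multiplying by a power of `2φ`.
  obtain ⟨M, g, hg⟩ : ∃ (M : ℕ) (g : R[X][X]), C (C ((2 * φ) ^ M)) * f = g.comp Ω := by
    clear hf
    induction f using Polynomial.induction_on' with
    | add p q hp hq =>
      obtain ⟨M, g, hg⟩ := hp
      obtain ⟨M', g', hg'⟩ := hq
      refine ⟨M + M', C (C ((2 * φ) ^ M')) * g + C (C ((2 * φ) ^ M)) * g', ?_⟩
      simp only [add_comp, mul_comp, C_comp, ← hg, ← hg', pow_add, C_mul]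
      ring
    | monomial n a =>
      refine ⟨n, C a * (C m - X) ^ n, ?_⟩
      simp only [mul_comp, pow_comp, sub_comp, C_comp, X_comp, hΩ, ← C_mul_X_pow_eq_monomial]
      rw [sub_sub_cancel, mul_pow (C (C (2 * φ))), ← C_pow, ← C_pow]
      ring
  -- `Ω` is fixed and has positive degree in `Y`, so composition with it is injective; invariance of
  -- `f` passes to the coefficients of `g`, which are then fixed by `X ↦ X + φ` and hence constant.
  have hgσ : g.map (compRingHom (X + C φ)) = g := by
    have h1 : (g.map (compRingHom (X + C φ))).comp Ω = g.comp Ω := by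
      have h3 := congrArg (triHom 1 φ 1 X) hg
      rw [map_mul, hf, triHom_C, C_comp, hg] at h3
      rw [h3]
      clear hg h3
      induction g using Polynomial.induction_on' with
      | add p q hp hq => simp only [add_comp, Polynomial.map_add, map_add, hp, hq]
      | monomial n a =>
        rw [← C_mul_X_pow_eq_monomial]
        simp only [mul_comp, pow_comp, C_comp, X_comp, map_mul, map_pow, hΩσ, triHom_C,
          Polynomial.map_mul, Polynomial.map_pow, map_C, map_X, coe_compRingHom_apply, C_1, one_mul]
    have h2 : (g.map (compRingHom (X + C φ)) - g).comp Ω = 0 := by rw [sub_comp, h1, sub_self]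
    rw [comp_eq_zero_iff] at h2
    rcases h2 with h2 | ⟨-, h2⟩
    · exact sub_eq_zero.1 h2
    · rw [h2] at hΩdeg; simp at hΩdeg
  obtain ⟨h, rfl⟩ : ∃ h : R[X], g = h.map C := by
    have : g ∈ lifts (C : R →+* R[X]) := by
      rw [lifts_iff_coeff_lifts]
      intro n
      have h1 := congrArg (fun p => p.coeff n) hgσ
      simp only [coeff_map, coe_compRingHom_apply] at h1
      exact ⟨_, (eq_C_of_natDegree_eq_zero (natDegree_eq_zero_of_comp_X_add_C hφ h1)).symm⟩
    obtain ⟨h, hh⟩ := (mem_lifts _).1 this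
    exact ⟨h, hh.symm⟩
  have hcomp : ∀ p : R[X], (p.map C).comp Ω = aeval Ω p := by
    intro p
    rw [comp, eval₂_map, aeval_def]; rfl
  -- Setting `Y = 0` turns `Ω` into the monic `m`, so the factor `(2φ) ^ M` must divide `h` itself
  -- and can be cancelled.
  have hh : h.comp m = C ((2 * φ) ^ M) * f.eval 0 := by
    have h1 := congrArg (eval 0) hg
    rw [eval_mul, eval_C, eval_comp, hΩ] at h1
    simp only [eval_sub, eval_mul, eval_C, eval_X, mul_zero, sub_zero] at h1
    rw [h1, eval_map]; rfl
  obtain ⟨h', rfl⟩ := exists_eq_C_mul_of_comp hmm (by omega) _ h _ hh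
  refine ⟨h', ?_⟩
  have hne : (C (C ((2 * φ) ^ M)) : R[X][X]) ≠ 0 := by simpa using fun h => absurd h hφ
  apply mul_left_cancel₀ hne
  rw [hg, hcomp, map_mul, aeval_C]; rfl

end Fixed

/-! ### The case of a zero root: a model on arrays of coefficients -/

section Array

variable {R : Type*} [CommRing R] (r φ : R)

/-- The element `τ ^ i (X)` for `τ : X ↦ r X + φ`. -/
noncomputable def affIter : ℕ → R[X]
  | 0 => X
  | i + 1 => r • affIter i + C φ

/-- Left multiplication by `u` on the coefficients of `∑ u ^ i f_{ik} d ^ k`. -/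
noncomputable def arrU (R : Type*) [CommRing R] : Module.End R (ℕ → ℕ → R[X]) where
  toFun F i k := match i with
    | 0 => 0
    | i + 1 => F i k
  map_add' F G := by ext i k : 2; cases i <;> simp
  map_smul' c F := by ext i k : 2; cases i <;> simp

/-- Left multiplication by `d` on the coefficients of `∑ u ^ i f_{ik} d ^ k`. -/
noncomputable def arrD : Module.End R (ℕ → ℕ → R[X]) where
  toFun F i k := affIter r φ i * F (i + 1) k + match i, k with
    | 0, k + 1 => aeval (r • X + C φ) (F 0 k)
    | _, _ => 0
  map_add' F G := by ext i k : 2; rcases i with _ | i <;> rcases k with _ | k <;> simp <;> ring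
  map_smul' c F := by ext i k : 2; rcases i with _ | i <;> rcases k with _ | k <;> simp

/-- Right multiplication by `u` on the coefficients of `∑ u ^ i f_{ik} d ^ k`. -/
noncomputable def arrRU : Module.End R (ℕ → ℕ → R[X]) where
  toFun F i k := affIter r φ k * F i (k + 1) + match i, k with
    | i + 1, 0 => aeval (r • X + C φ) (F i 0)
    | _, _ => 0
  map_add' F G := by ext i k : 2; rcases i with _ | i <;> rcases k with _ | k <;> simp <;> ring
  map_smul' c F := by ext i k : 2; rcases i with _ | i <;> rcases k with _ | k <;> simp

/-- Right multiplication by `d` on the coefficients of `∑ u ^ i f_{ik} d ^ k`. -/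
noncomputable def arrRD (R : Type*) [CommRing R] : Module.End R (ℕ → ℕ → R[X]) where
  toFun F i k := match k with
    | 0 => 0
    | k + 1 => F i k
  map_add' F G := by ext i k : 2; cases k <;> simp
  map_smul' c F := by ext i k : 2; cases k <;> simp

/-- The coefficients of `1`. -/
noncomputable def arrOne (R : Type*) [CommRing R] : ℕ → ℕ → R[X]
  | 0, 0 => 1
  | _, _ => 0

@[simp] theorem arrU_zero (F : ℕ → ℕ → R[X]) (k : ℕ) : arrU R F 0 k = 0 := rfl

@[simp] theorem arrU_succ (F : ℕ → ℕ → R[X]) (i k : ℕ) : arrU R F (i + 1) k = F i k := rfl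

@[simp] theorem arrD_zero_zero (F : ℕ → ℕ → R[X]) : arrD r φ F 0 0 = X * F 1 0 := add_zero _

@[simp] theorem arrD_zero_succ (F : ℕ → ℕ → R[X]) (k : ℕ) :
    arrD r φ F 0 (k + 1) = X * F 1 (k + 1) + aeval (r • X + C φ) (F 0 k) := rfl

@[simp] theorem arrD_succ (F : ℕ → ℕ → R[X]) (i k : ℕ) :
    arrD r φ F (i + 1) k = affIter r φ (i + 1) * F (i + 2) k := add_zero _

@[simp] theorem arrRU_zero_zero (F : ℕ → ℕ → R[X]) : arrRU r φ F 0 0 = X * F 0 1 := add_zero _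

@[simp] theorem arrRU_succ_zero (F : ℕ → ℕ → R[X]) (i : ℕ) :
    arrRU r φ F (i + 1) 0 = X * F (i + 1) 1 + aeval (r • X + C φ) (F i 0) := rfl

@[simp] theorem arrRU_succ (F : ℕ → ℕ → R[X]) (i k : ℕ) :
    arrRU r φ F i (k + 1) = affIter r φ (k + 1) * F i (k + 2) := by
  cases i <;> exact add_zero _

@[simp] theorem arrRD_zero (F : ℕ → ℕ → R[X]) (i : ℕ) : arrRD R F i 0 = 0 := rfl

@[simp] theorem arrRD_succ (F : ℕ → ℕ → R[X]) (i k : ℕ) : arrRD R F i (k + 1) = F i k := rfl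

@[simp] theorem arrOne_zero_zero : arrOne R 0 0 = 1 := rfl

@[simp] theorem arrOne_succ_left (i k : ℕ) : arrOne R (i + 1) k = 0 := rfl

@[simp] theorem arrOne_succ_right (i k : ℕ) : arrOne R i (k + 1) = 0 := by cases i <;> rfl

theorem aeval_affIter (i : ℕ) :
    aeval (r • X + C φ) (affIter r φ i) = affIter r φ (i + 1) := by
  induction i with
  | zero => simp [affIter]
  | succ i ih => conv_lhs => rw [affIter, map_add, map_smul, ih, aeval_C]
                 rfl

theorem arrD_arrU (F : ℕ → ℕ → R[X]) (i k : ℕ) :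
    arrD r φ (arrU R F) i k = affIter r φ i * F i k := by
  rcases i with _ | i <;> rcases k with _ | k <;> simp [affIter]

/-- `du` multiplies row `i` by `τ ^ i (X)`, and the recursion `τ ^ (i + 1) (X) = r τ ^ i (X) + φ` is
the down-up relation for `s = 0`. -/
theorem isDownUpPair_arr : IsDownUpPair r 0 φ (arrU R) (arrD r φ) := by
  constructor
  · ext F i k : 3
    simp only [Module.End.mul_apply, LinearMap.add_apply,
      LinearMap.smul_apply, Pi.add_apply, Pi.smul_apply, arrD_arrU, add_zero,
      mul_zero, zero_smul, sub_zero]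
    rcases i with _ | i <;> rcases k with _ | k <;>
      simp [arrD_arrU, affIter, smul_eq_C_mul] <;> ring
  · ext F i k : 3
    simp only [Module.End.mul_apply, LinearMap.add_apply,
      LinearMap.smul_apply, Pi.add_apply, Pi.smul_apply, arrD_arrU, add_zero,
      mul_zero, zero_smul, sub_zero]
    rcases i with _ | i
    · simp
    · simp [arrD_arrU, affIter, smul_eq_C_mul]; ring

/-- Right multiplications commute with left ones. Together with the agreement of both on `arrOne`,
this identifies the coefficients of `a * u` and `a * d` with `arrRU` and `arrRD` of those of `a`. -/
theorem commute_arrRU_arrU : Commute (arrRU r φ) (arrU R) := by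
  ext F i k : 3
  simp only [Module.End.mul_apply]
  rcases i with _ | _ | i <;> rcases k with _ | k <;> simp

theorem commute_arrRU_arrD : Commute (arrRU r φ) (arrD r φ) := by
  ext F i k : 3
  simp only [Module.End.mul_apply]
  rcases i with _ | i <;> rcases k with _ | k
  · simp
  · rcases k with _ | k <;> simp [aeval_affIter, affIter] <;> ring
  · rcases i with _ | i <;> simp [aeval_affIter, affIter] <;> ring
  · simp; ring

theorem commute_arrRD_arrU : Commute (arrRD R) (arrU R) := by
  ext F i k : 3
  simp only [Module.End.mul_apply]
  rcases i with _ | i <;> rcases k with _ | k <;> simp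

theorem commute_arrRD_arrD : Commute (arrRD R) (arrD r φ) := by
  ext F i k : 3
  simp only [Module.End.mul_apply]
  rcases i with _ | i <;> rcases k with _ | _ | k <;> simp

theorem arrU_arrOne : arrU R (arrOne R) = arrRU r φ (arrOne R) := by
  ext i k : 2
  rcases i with _ | _ | i <;> rcases k with _ | k <;> simp

theorem arrD_arrOne : arrD r φ (arrOne R) = arrRD R (arrOne R) := by
  ext i k : 2
  rcases i with _ | i <;> rcases k with _ | _ | k <;> simp

theorem arrD_pow_arrOne (n : ℕ) (i k : ℕ) :
    (arrD r φ ^ n) (arrOne R) i k = if i = 0 ∧ k = n then 1 else 0 := by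
  induction n generalizing i k with
  | zero => rcases i with _ | i <;> rcases k with _ | k <;> simp
  | succ n ih =>
    rw [pow_succ', Module.End.mul_apply]
    rcases i with _ | i <;> rcases k with _ | k <;> simp [ih]

theorem arrU_pow_apply (n : ℕ) (F : ℕ → ℕ → R[X]) (i k : ℕ) :
    (arrU R ^ n) F i k = if n ≤ i then F (i - n) k else 0 := by
  induction n generalizing i with
  | zero => simp
  | succ n ih =>
    rw [pow_succ', Module.End.mul_apply]
    rcases i with _ | i
    · simp
    · simp [ih]

end Array

/-! ### The center when one root is zero -/

section Degenerate

universe v w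

variable {R : Type v} {A : Type w} [CommRing R] [Ring A] [Algebra R A] {r φ : R} {u d : A}

/-- For `s = 0` the relation is `d (du) = (r du + φ) d`, so moving `d` to the right substitutes `rX
+ φ` for `X`. -/
theorem IsDownUpPair.d_mul_aeval (h : IsDownUpPair r 0 φ u d) (f : R[X]) :
    d * aeval (d * u) f = aeval (d * u) (aeval (r • X + C φ : R[X]) f) * d := by
  have h1 := h.ddu
  simp only [add_zero, mul_zero, zero_smul, sub_zero] at h1
  have hX : d * (d * u) = aeval (d * u) (r • X + C φ : R[X]) * d := by
    rw [map_add, map_smul, aeval_X, aeval_C, ← mul_assoc, h1, add_mul, Algebra.smul_def φ,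
      smul_mul_assoc]
  induction f using Polynomial.induction_on with
  | C c => simp only [aeval_C, algebraMap_eq, Algebra.commutes]
  | add p q hp hq => simp only [map_add, mul_add, add_mul, hp, hq]
  | monomial n c ih =>
    rw [pow_succ, ← mul_assoc]
    generalize C c * X ^ n = p at ih ⊢
    rw [map_mul, map_mul, map_mul, ← mul_assoc, ih, mul_assoc, aeval_X,
      hX, aeval_X, mul_assoc]

theorem IsDownUpPair.aeval_mul_u (h : IsDownUpPair r 0 φ u d) (f : R[X]) :
    aeval (d * u) f * u = u * aeval (d * u) (aeval (r • X + C φ : R[X]) f) := by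
  have h1 := h.duu
  simp only [add_zero, mul_zero, zero_smul, sub_zero] at h1
  have hX : (d * u) * u = u * aeval (d * u) (r • X + C φ : R[X]) := by
    rw [map_add, map_smul, aeval_X, aeval_C, h1, mul_add, ← Algebra.commutes,
      ← Algebra.smul_def φ, mul_smul_comm, mul_assoc]
  induction f using Polynomial.induction_on with
  | C c => simp only [aeval_C, algebraMap_eq, Algebra.commutes]
  | add p q hp hq => simp only [map_add, mul_add, add_mul, hp, hq]
  | monomial n c ih =>
    rw [pow_succ, ← mul_assoc]
    generalize C c * X ^ n = p at ih ⊢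
    rw [map_mul, map_mul, map_mul, mul_assoc, aeval_X, hX, ← mul_assoc,
      ih, aeval_X, mul_assoc]

theorem IsDownUpPair.d_pow_mul_u (h : IsDownUpPair r 0 φ u d) (k : ℕ) :
    d ^ (k + 1) * u = aeval (d * u) (affIter r φ k) * d ^ k := by
  induction k with
  | zero => simp [affIter]
  | succ k ih =>
    rw [pow_succ', mul_assoc, ih, ← mul_assoc, h.d_mul_aeval, aeval_affIter, mul_assoc, ← pow_succ']

/-- The element with coefficients `F` with respect to the monomials `u ^ i` and `d ^ k`. -/
noncomputable def ofArr (u d : A) (F : ℕ × ℕ →₀ R[X]) : A :=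
  F.sum fun p f => u ^ p.1 * aeval (d * u) f * d ^ p.2

theorem IsDownUp.exists_ofArr (h : IsDownUp r 0 φ u d) (a : A) : ∃ F, a = ofArr (R := R) u d F := by
  let T : ℕ × ℕ → R[X] →ₗ[R] A := fun p =>
    LinearMap.mulRight R (d ^ p.2) ∘ₗ LinearMap.mulLeft R (u ^ p.1) ∘ₗ
      (aeval (d * u) : R[X] →ₐ[R] A).toLinearMap
  let Φ : (ℕ × ℕ →₀ R[X]) →ₗ[R] A := Finsupp.lsum R T
  have hΦ : ∀ F, Φ F = ofArr u d F := fun F => rfl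
  have hmem : ∀ i k (f : R[X]), u ^ i * aeval (d * u) f * d ^ k ∈ LinearMap.range Φ := fun i k f =>
    ⟨Finsupp.single (i, k) f, by simp [hΦ, ofArr]⟩
  have key : ∀ a, ∀ z ∈ LinearMap.range Φ, z * a ∈ LinearMap.range Φ := by
    have hstep : ∀ y : A, (∀ i k (f : R[X]), u ^ i * aeval (d * u) f * d ^ k * y ∈ LinearMap.range Φ) →
        ∀ z ∈ LinearMap.range Φ, z * y ∈ LinearMap.range Φ := by
      rintro y hy _ ⟨F, rfl⟩
      rw [hΦ, ofArr, Finsupp.sum, Finset.sum_mul]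
      exact Submodule.sum_mem _ fun k _ => hy _ _ _
    intro a
    have ha : a ∈ Algebra.adjoin R {u, d} := by rw [h.adjoin_eq_top]; trivial
    induction ha using Algebra.adjoin_induction with
    | mem y hy =>
      apply hstep
      intro i k f
      obtain rfl | rfl := hy
      · cases k with
        | zero =>
          rw [pow_zero, mul_one, mul_assoc, h.aeval_mul_u, ← mul_assoc, ← pow_succ]
          simpa using hmem (i + 1) 0 _
        | succ k =>
          rw [mul_assoc, h.d_pow_mul_u, ← mul_assoc, mul_assoc (y ^ i), ← map_mul]
          exact hmem _ _ _
      · rw [mul_assoc, ← pow_succ]; exact hmem _ _ _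
    | algebraMap c =>
      intro z hz
      rw [← Algebra.commutes, ← Algebra.smul_def]
      exact Submodule.smul_mem _ _ hz
    | add y y' _ _ hy hy' =>
      intro z hz
      rw [mul_add]
      exact add_mem (hy z hz) (hy' z hz)
    | mul y y' _ _ hy hy' =>
      intro z hz
      rw [← mul_assoc]
      exact hy' _ (hy _ hz)
  obtain ⟨F, hF⟩ := key a 1 (by simpa using hmem 0 0 1)
  exact ⟨F, by rw [← hΦ, hF, one_mul]⟩

/-- The coefficients with respect to the monomials `u ^ i` and `d ^ k`, and their behaviour under
multiplication by the generators. -/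
theorem IsDownUp.exists_arrCoeff (h : IsDownUp r 0 φ u d) :
    ∃ κ : A →ₗ[R] (ℕ → ℕ → R[X]),
      (∀ F i k, κ (ofArr u d F) i k = F (i, k)) ∧
      (∀ a, κ (u * a) = arrU R (κ a)) ∧ (∀ a, κ (d * a) = arrD r φ (κ a)) ∧
      (∀ a, κ (a * u) = arrRU r φ (κ a)) ∧ (∀ a, κ (a * d) = arrRD R (κ a)) := by
  obtain ⟨ρ, hρu, hρd⟩ := h.exists_lift (ℕ → ℕ → R[X]) (arrU R) (arrD r φ) (isDownUpPair_arr r φ)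
  have hcomm : ∀ T : Module.End R (ℕ → ℕ → R[X]), Commute T (arrU R) → Commute T (arrD r φ) →
      ∀ a, Commute T (ρ a) := by
    intro T hU hD a
    have ha : a ∈ Algebra.adjoin R {u, d} := by rw [h.adjoin_eq_top]; trivial
    induction ha using Algebra.adjoin_induction with
    | mem y hy =>
      obtain rfl | rfl := hy
      · rwa [hρu]
      · rwa [hρd]
    | algebraMap c => rw [AlgHom.commutes]; exact (Algebra.commutes c T).symm
    | add y y' _ _ hy hy' => rw [map_add]; exact hy.add_right hy'
    | mul y y' _ _ hy hy' => rw [map_mul]; exact hy.mul_right hy'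
  have hρf : ∀ (f : R[X]) F i k, ρ (aeval (d * u) f) F i k = aeval (affIter r φ i) f * F i k := by
    intro f
    induction f using Polynomial.induction_on with
    | C c => intro F i k; simp [smul_eq_C_mul]
    | add p q hp hq =>
      intro F i k
      rw [map_add, map_add, LinearMap.add_apply, Pi.add_apply, Pi.add_apply, hp, hq, map_add,
        add_mul]
    | monomial n c ih =>
      intro F i k
      rw [pow_succ, ← mul_assoc]
      generalize C c * X ^ n = p at ih ⊢
      rw [map_mul, map_mul, Module.End.mul_apply, ih, aeval_X, map_mul, hρu,
        hρd, Module.End.mul_apply, arrD_arrU, map_mul, aeval_X, mul_assoc]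
  -- The coefficients of `a` are the array `ρ a` applied to that of `1`.
  refine ⟨LinearMap.applyₗ (arrOne R) ∘ₗ ρ.toLinearMap, fun F i k => ?_, fun a => ?_, fun a => ?_,
    fun a => ?_, fun a => ?_⟩ <;>
    simp only [LinearMap.comp_apply, AlgHom.toLinearMap_apply, LinearMap.applyₗ_apply_apply,
      map_mul, Module.End.mul_apply, hρu, hρd]
  · rw [ofArr, Finsupp.sum, map_sum, LinearMap.sum_apply, Finset.sum_apply, Finset.sum_apply,
      Finset.sum_eq_single (i, k)]
    · rw [map_mul, map_mul, map_pow, map_pow, hρu, hρd, Module.End.mul_apply, Module.End.mul_apply,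
        arrU_pow_apply, if_pos le_rfl, hρf, arrD_pow_arrOne]
      simp [affIter]
    · rintro ⟨i', k'⟩ - hne
      rw [map_mul, map_mul, map_pow, map_pow, hρu, hρd, Module.End.mul_apply, Module.End.mul_apply,
        arrU_pow_apply]
      split_ifs with hi
      · rw [hρf, arrD_pow_arrOne, if_neg, mul_zero]
        rintro ⟨h1, h2⟩
        simp only at hi h1 h2
        exact hne (Prod.ext (by simp only; omega) h2.symm)
      · rfl
    · intro hF
      rw [Finsupp.notMem_support_iff.1 hF]
      simp
  · rw [arrU_arrOne r φ, ← Module.End.mul_apply, ← Module.End.mul_apply,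
      (hcomm _ (commute_arrRU_arrU r φ) (commute_arrRU_arrD r φ) a).eq]
  · rw [arrD_arrOne r φ, ← Module.End.mul_apply, ← Module.End.mul_apply,
      (hcomm _ commute_arrRD_arrU (commute_arrRD_arrD r φ) a).eq]

/-- Commuting with `u` expresses each coefficient at `(i, k + 1)` as a multiple of the one at `(i +
1, k + 2)`, and commuting with `d` does the same at `(i + 1, k)`. Finite support makes all of these
vanish along the diagonals, leaving `(0, 0)`. -/
theorem IsDownUp.exists_aeval_of_mem_center (h : IsDownUp r 0 φ u d) {z : A}
    (hz : z ∈ Subalgebra.center R A) :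
    ∃ f : R[X], z = aeval (d * u) f ∧ f.comp (C r * X + C φ) = f := by
  obtain ⟨κ, hκ, hκu, hκd, hκu', hκd'⟩ := h.exists_arrCoeff
  obtain ⟨F, rfl⟩ := h.exists_ofArr z
  rw [Subalgebra.mem_center_iff] at hz
  have hu : arrU R (κ (ofArr u d F)) = arrRU r φ (κ (ofArr u d F)) := by rw [← hκu, ← hκu', hz]
  have hd : arrD r φ (κ (ofArr u d F)) = arrRD R (κ (ofArr u d F)) := by rw [← hκd, ← hκd', hz]
  obtain ⟨N, hN⟩ : ∃ N, ∀ i k, N ≤ i ∨ N ≤ k → F (i, k) = 0 := by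
    refine ⟨F.support.sup (fun p => p.1 + p.2) + 1, fun i k hik => ?_⟩
    by_contra hne
    have := Finset.le_sup (f := fun p : ℕ × ℕ => p.1 + p.2) (Finsupp.mem_support_iff.2 hne)
    simp only at this
    omega
  have hright : ∀ n i k, N ≤ i + n → F (i, k + 1) = 0 := by
    intro n
    induction n with
    | zero => intro i k hi; exact hN _ _ (.inl hi)
    | succ n ih =>
      intro i k hi
      have h1 := congrFun (congrFun hu (i + 1)) (k + 1)
      rw [arrU_succ, arrRU_succ, hκ, hκ, ih (i + 1) (k + 1) (by omega), mul_zero] at h1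
      exact h1
  have hleft : ∀ n i k, N ≤ k + n → F (i + 1, k) = 0 := by
    intro n
    induction n with
    | zero => intro i k hi; exact hN _ _ (.inr hi)
    | succ n ih =>
      intro i k hi
      have h1 := congrFun (congrFun hd (i + 1)) (k + 1)
      rw [arrRD_succ, arrD_succ, hκ, hκ, ih (i + 1) (k + 1) (by omega), mul_zero] at h1
      exact h1.symm
  refine ⟨F (0, 0), ?_, ?_⟩
  · rw [ofArr, Finsupp.sum_eq_single (0, 0)]
    · simp
    · rintro ⟨i, k⟩ _ hne
      have : F (i, k) = 0 := by
        rcases k with _ | k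
        · rcases i with _ | i
          · exact absurd rfl hne
          · exact hleft N i 0 (by omega)
        · exact hright N i k (by omega)
      simp [this]
    · simp
  · have h1 := congrFun (congrFun hu 1) 0
    rw [arrU_succ, arrRU_succ_zero, hκ, hκ, hright N _ _ (by omega), mul_zero, zero_add,
      smul_eq_C_mul] at h1
    exact h1.symm

theorem IsDownUp.mem_of_mem_center_of_zero [IsDomain R] (h : IsDownUp r 0 φ u d) {c : R}
    (hc : (r - 1) * c = φ) (S : Submodule R A) (hS : ∀ i, r ^ i = 1 → wt 0 c u d ^ i ∈ S) {z : A}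
    (hz : z ∈ Subalgebra.center R A) : z ∈ S := by
  obtain ⟨f, rfl, hf⟩ := h.exists_aeval_of_mem_center hz
  -- Recentering at the fixed point `-c` of `X ↦ rX + φ` turns this map into the scaling `X ↦ rX`,
  -- and `du` into `wt 0 c u d`.
  set g := f.comp (X - C c) with hg
  have hfg : f = g.comp (X + C c) := by rw [hg, comp_assoc]; simp
  have hgr : g.comp (C r * X) = g := by
    conv_rhs => rw [hg, ← hf]
    rw [hg, comp_assoc, comp_assoc]
    congr 1
    simp only [add_comp, sub_comp, mul_comp, C_comp, X_comp, one_comp, ← hc, C_mul, C_sub, C_1]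
    ring
  have hz : aeval (d * u) f = aeval (wt 0 c u d) g := by
    rw [hfg, aeval_comp]; simp [wt]
  rw [hz, aeval_eq_sum_range]
  refine S.sum_mem fun i _ => ?_
  by_cases hi : g.coeff i = 0
  · simp [hi]
  · refine S.smul_mem _ (hS i ?_)
    have h1 := congrArg (fun p => p.coeff i) hgr
    simp only [comp_C_mul_X_coeff] at h1
    exact mul_left_cancel₀ hi (by rw [h1, mul_one])

theorem IsDownUp.mem_range_of_mem_center_of_one_zero [IsDomain R] [CharZero R]
    (h : IsDownUp 1 0 φ u d) (hφ : φ ≠ 0) {z : A} (hz : z ∈ Subalgebra.center R A) :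
    ∃ a, z = algebraMap R A a := by
  obtain ⟨f, rfl, hf⟩ := h.exists_aeval_of_mem_center hz
  rw [C_1, one_mul] at hf
  have := eq_C_of_natDegree_eq_zero (natDegree_eq_zero_of_comp_X_add_C hφ hf)
  exact ⟨f.coeff 0, by conv_lhs => rw [this, aeval_C]⟩

end Degenerate

theorem adjoin_eq_top_of_mem {R : Type*} [CommRing R] {S : Set R[X][X]}
    (hX : C X ∈ Algebra.adjoin R S) (hY : X ∈ Algebra.adjoin R S) : Algebra.adjoin R S = ⊤ := by
  rw [eq_top_iff, ← adjoin_X_Y, Algebra.adjoin_le_iff]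
  rintro y (rfl | rfl)
  exacts [hX, hY]

theorem C_C_mul_mem {R : Type*} [CommRing R] (S : Subalgebra R R[X][X]) (a : R) {y : R[X][X]}
    (hy : y ∈ S) : C (C a) * y ∈ S :=
  S.mul_mem (S.algebraMap_mem a) hy

theorem C_C_mem {R : Type*} [CommRing R] (S : Subalgebra R R[X][X]) (a : R) : C (C a) ∈ S :=
  S.algebraMap_mem a

theorem smul_eq_C_C_mul {R : Type*} [CommRing R] (a : R) (f : R[X][X]) : a • f = C (C a) * f :=
  Algebra.smul_def a f

theorem algebraMap_eq_C_C {R : Type*} [CommRing R] (a : R) :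
    algebraMap R R[X][X] a = C (C a) := rfl

/-! ### Orders of the triangular automorphisms -/

section Order

variable {R : Type*} [CommRing R]

theorem triEquiv_pow_X (s r : Rˣ) (g : R[X]) (n : ℕ) :
    (triEquiv s r 0 g ^ n) (C X) = C (C ((s : R) ^ n) * X) := by
  induction n with
  | zero => simp
  | succ n ih =>
    rw [pow_succ', AlgEquiv.mul_apply, ih, triEquiv_apply, triHom_C]
    simp [pow_succ, mul_assoc]

theorem triEquiv_pow_Y (s r : Rˣ) (n : ℕ) :
    (triEquiv s r 0 0 ^ n) X = C (C ((r : R) ^ n)) * X := by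
  induction n with
  | zero => simp
  | succ n ih =>
    rw [pow_succ', AlgEquiv.mul_apply, ih, triEquiv_apply, map_mul, triHom_C, triHom_Y]
    simp [pow_succ, mul_assoc]

theorem pow_eq_one_of_triEquiv_pow {s r : Rˣ} {n : ℕ} (h : triEquiv s r 0 0 ^ n = 1) :
    (s : R) ^ n = 1 ∧ (r : R) ^ n = 1 := by
  have hX := triEquiv_pow_X s r 0 n
  have hY := triEquiv_pow_Y s r n
  rw [h, AlgEquiv.one_apply] at hX hY
  refine ⟨?_, ?_⟩
  · have := congrArg (fun f => (f.coeff 0).coeff 1) hX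
    simpa [-map_pow] using this.symm
  · have := congrArg (fun f => (f.coeff 1).coeff 0) hY
    simpa [-map_pow] using this.symm

theorem triEquiv_jordan_pow_ne_one [IsDomain R] [CharZero R] {s r : Rˣ} {γ : R} {e : ℕ}
    (hr : (r : R) = (s : R) ^ e) (hγ : γ ≠ 0) {n : ℕ} (hn : 0 < n) :
    triEquiv s r 0 (C γ * X ^ e) ^ n ≠ 1 := by
  -- The extra factor `r` avoids the exponent `n - 1` in `σ ^ n (Y) = r ^ n Y + n r ^ (n - 1) γ X ^
  -- e`.
  have hY : ∀ n : ℕ, C (C (r : R)) * (triEquiv s r 0 (C γ * X ^ e) ^ n) X =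
      C (C ((r : R) ^ (n + 1))) * X + C (C (n * (r : R) ^ n * γ) * X ^ e) := by
    intro n
    induction n with
    | zero => simp
    | succ n ih =>
      have h1 : C (C (r : R)) = triEquiv s r 0 (C γ * X ^ e) (C (C (r : R))) := by
        rw [triEquiv_apply, triHom_C, C_comp]
      rw [pow_succ', AlgEquiv.mul_apply, h1, ← map_mul, ih, triEquiv_apply, map_add, map_mul,
        triHom_C, triHom_Y, triHom_C]
      simp only [mul_comp, C_comp, X_comp, pow_comp, C_0, add_zero, mul_pow, ← C_pow, ← hr]
      simp only [C_mul, C_pow, Nat.cast_succ, C_add, C_1]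
      ring
  intro h
  have h1 := congrArg (fun f => (f.coeff 0).coeff e) (hY n)
  rw [h] at h1
  have hr0 : (r : R) ≠ 0 := r.ne_zero
  simp [-map_pow, -map_mul, -map_natCast, hγ, hr0, hn.ne'] at h1

end Order

/-! ### Upper bounds for the center, by normal form of the automorphism -/

section Cases

universe v w

variable {R : Type v} {A : Type w} [CommRing R] [IsDomain R] [Ring A] [Algebra R A] {φ : R}
  {u d : A}

/-- With `X = H` and `Y = L` one has `H - L = (s - r) ud + c - c'`, which is solved for `ud` because
`s - r` is invertible; this is the choice of `x`. -/
theorem IsDownUp.exists_isWeyl_diag {r s : Rˣ} (h : IsDownUp (r : R) (s : R) φ u d) {c c' κ : R}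
    (hc : ((s : R) - 1) * c = φ) (hc' : ((r : R) - 1) * c' = φ) (hκ : κ * ((s : R) - r) = 1) :
    ∃ (x : R[X][X]) (ι : R[X][X] →ₐ[R] A), ι (C X) = wt (r : R) c u d ∧ ι X = wt (s : R) c' u d ∧
      IsWeyl (triEquiv s r 0 0) x ι u d ∧
      triEquiv s r 0 0 (triEquiv s r 0 0 x) = ((r : R) + s) • triEquiv s r 0 0 x -
        ((r : R) * s) • x + algebraMap R R[X][X] φ ∧
      Algebra.adjoin R {x, triEquiv s r 0 0 x} = ⊤ ∧ x ≠ 0 := by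
  obtain ⟨ι, hιX, hιY⟩ := exists_algHom_of_commute (R := R) (h.commute_wt (r : R) s c c')
  -- This matches the constant of `sH - rL = (s - r) du + sc - rc'` with the one appearing in `σ x`.
  have hcc : (s : R) * c - r * c' = c - c' := by linear_combination hc - hc'
  set x : R[X][X] := C (C κ) * (C X - X - C (C (c - c'))) with hxdef
  have hσx : triEquiv s r 0 0 x =
      C (C κ) * (C (C (s : R)) * C X - C (C (r : R)) * X - C (C (c - c'))) := by
    rw [triEquiv_apply, hxdef]
    simp only [map_mul, map_sub (triHom _ _ _ _), triHom_C, triHom_Y, C_comp, X_comp, C_0,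
      add_zero]
  have hσσx : triEquiv s r 0 0 (triEquiv s r 0 0 x) =
      C (C κ) * (C (C (s : R)) ^ 2 * C X - C (C (r : R)) ^ 2 * X - C (C (c - c'))) := by
    rw [hσx, triEquiv_apply]
    simp only [map_mul, map_sub (triHom _ _ _ _), triHom_C, triHom_Y, C_comp, X_comp, C_0,
      add_zero]
    ring
  have hκC : C (C κ) * (C (C (s : R)) - C (C (r : R))) = (1 : R[X][X]) := by
    simp only [← C_sub, ← C_mul, hκ, C_1]
  have hιC : ∀ a : R, ι (C (C a)) = algebraMap R A a := fun a => ι.commutes a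
  have hx : triEquiv s r 0 0 (triEquiv s r 0 0 x) = ((r : R) + s) • triEquiv s r 0 0 x -
        ((r : R) * s) • x + algebraMap R R[X][X] φ := by
    have hφ : (r - 1) * (s - 1) * (c - c') = (r - s) * φ := by
      linear_combination (r - 1) * hc - (s - 1) * hc'
    have hφC := congrArg (fun a => C (C a) : R → R[X][X]) hφ
    simp only [C_mul, C_sub, C_1] at hφC
    rw [hσσx, hσx, hxdef]
    simp only [smul_eq_C_C_mul, algebraMap_eq_C_C, C_mul, C_add, C_sub]
    linear_combination -C (C κ) * hφC + C (C φ) * hκC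
  have hgen : Algebra.adjoin R {x, triEquiv s r 0 0 x} = ⊤ := by
    set S := Algebra.adjoin R {x, triEquiv s r 0 0 x} with hS
    have h1 : x ∈ S := Algebra.subset_adjoin (by simp)
    have h2 : triEquiv s r 0 0 x ∈ S := Algebra.subset_adjoin (by simp)
    have hX : C X = triEquiv s r 0 0 x - C (C (r : R)) * x +
        C (C (κ * (1 - r) * (c - c'))) := by
      rw [hσx, hxdef]; simp only [C_mul, C_sub, C_1]
      linear_combination -C X * hκC
    have hX' : C X ∈ S := by
      rw [hX]; exact add_mem (sub_mem h2 (C_C_mul_mem _ _ h1)) (C_C_mem _ _)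
    have hY : X = C X - C (C ((s : R) - r)) * x - C (C (c - c')) := by
      rw [hxdef]; simp only [C_sub]
      linear_combination (C X - X - (C (C c) - C (C c'))) * hκC
    refine adjoin_eq_top_of_mem hX' ?_
    rw [hY]; exact sub_mem (sub_mem hX' (C_C_mul_mem _ _ h1)) (C_C_mem _ _)
  have hιx : ι x = u * d := by
    rw [hxdef, map_mul, map_sub, map_sub, hιX, hιY, hιC, hιC, ← Algebra.smul_def]
    simp only [wt, map_sub]
    calc _ = (κ * ((s : R) - r)) • (u * d) := by simp only [mul_smul, sub_smul]; congr 1; abel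
      _ = _ := by rw [hκ, one_smul]
  have hισx : ι (triEquiv s r 0 0 x) = d * u := by
    rw [hσx, map_mul, map_sub, map_sub, map_mul, map_mul, hιX, hιY, hιC, hιC, hιC, hιC,
      ← Algebra.smul_def, ← Algebra.smul_def, ← Algebra.smul_def, ← hcc]
    simp only [wt, Algebra.algebraMap_eq_smul_one]
    calc _ = (κ * ((s : R) - r)) • (d * u) := by module
      _ = _ := by rw [hκ, one_smul]
  refine ⟨x, ι, hιX, hιY, h.isWeyl hx hgen hιx hισx, hx, hgen, fun h0 => ?_⟩
  have := congrArg (fun f => (f.coeff 1).coeff 0) h0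
  have hκ0 : κ ≠ 0 := left_ne_zero_of_mul_eq_one hκ
  simp [hxdef, hκ0, coeff_C] at this

theorem IsDownUp.mem_of_mem_center_diag {r s : Rˣ} (h : IsDownUp (r : R) (s : R) φ u d)
    {c c' κ : R} (hc : ((s : R) - 1) * c = φ) (hc' : ((r : R) - 1) * c' = φ)
    (hκ : κ * ((s : R) - r) = 1) (S : Subalgebra R A)
    (hS : ∀ i j, (s : R) ^ i * (r : R) ^ j = 1 → wt (r : R) c u d ^ i * wt (s : R) c' u d ^ j ∈ S)
    (hud : ∀ k, (s : R) ^ k = 1 → (r : R) ^ k = 1 → u ^ k ∈ S ∧ d ^ k ∈ S) {z : A}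
    (hz : z ∈ Subalgebra.center R A) : z ∈ S := by
  obtain ⟨x, ι, hιX, hιY, hW, hx, hgen, hx0⟩ := h.exists_isWeyl_diag hc hc' hκ
  obtain ⟨F, rfl, hF⟩ := hW.exists_of_mem_center h hx hgen hx0 hz
  refine S.sum_mem fun k hk => S.mul_mem ?_ ?_
  · refine algHom_apply_mem ι (Subalgebra.toSubmodule S) (F k) fun i j hij => ?_
    rw [hιX, hιY]
    exact hS i j (pow_mul_pow_eq_one_of_fixed (hF k).1 hij)
  · have h1 := (hF k).2 (Finsupp.mem_support_iff.1 hk)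
    obtain ⟨m, rfl | rfl⟩ := k.eq_nat_or_neg
    · rw [zpow_natCast] at h1
      obtain ⟨h2, h3⟩ := pow_eq_one_of_triEquiv_pow h1
      rw [word_natCast]; exact (hud m h2 h3).1
    · rw [zpow_neg, zpow_natCast, inv_eq_one] at h1
      obtain ⟨h2, h3⟩ := pow_eq_one_of_triEquiv_pow h1
      rw [word_neg_natCast]; exact (hud m h2 h3).2

theorem IsWeyl.mem_of_mem_center_jordan [CharZero R] {r s a b : Rˣ}
    {γ : R} {e : ℕ} {x : R[X][X]} {ι : R[X][X] →ₐ[R] A}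
    (hW : IsWeyl (triEquiv s r 0 (C γ * X ^ e)) x ι u d) (h : IsDownUp (a : R) (b : R) φ u d)
    (hx : triEquiv s r 0 (C γ * X ^ e) (triEquiv s r 0 (C γ * X ^ e) x) =
      ((a : R) + b) • triEquiv s r 0 (C γ * X ^ e) x - ((a : R) * b) • x + algebraMap R R[X][X] φ)
    (hgen : Algebra.adjoin R {x, triEquiv s r 0 (C γ * X ^ e) x} = ⊤) (hx0 : x ≠ 0)
    (hr : (r : R) = (s : R) ^ e) (hγ : γ ≠ 0) (S : Subalgebra R A)
    (hS : ∀ i, (s : R) ^ i = 1 → ι (C X) ^ i ∈ S) {z : A} (hz : z ∈ Subalgebra.center R A) :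
    z ∈ S := by
  obtain ⟨f, rfl, hf⟩ := hW.exists_fixed_of_mem_center h hx hgen hx0
    (fun k hk => triEquiv_jordan_pow_ne_one hr hγ hk) hz
  refine algHom_apply_mem ι (Subalgebra.toSubmodule S) f fun i j hij => ?_
  obtain ⟨rfl, hs⟩ := fixed_of_jordan hr r.ne_zero hγ hf hij
  rw [pow_zero, mul_one]
  exact hS i hs

/-- Here `H` and `L` coincide, so the second coordinate is `Y = ud + e`. Since `du = H + r ud - c`,
the condition `(1 - r) e = c` makes `σ Y = rY + X`: a Jordan block with exponent `1` and `γ = 1`. -/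
theorem IsDownUp.mem_of_mem_center_equal [CharZero R] {r : Rˣ}
    (h : IsDownUp (r : R) (r : R) φ u d) {c e : R} (hc : ((r : R) - 1) * c = φ)
    (he : (1 - (r : R)) * e = c) (S : Subalgebra R A)
    (hS : ∀ i, (r : R) ^ i = 1 → wt (r : R) c u d ^ i ∈ S) {z : A}
    (hz : z ∈ Subalgebra.center R A) : z ∈ S := by
  have hcomm : Commute (wt (r : R) c u d) (u * d + algebraMap R A e) := by
    refine Commute.add_right ?_ (Algebra.commutes e _).symm
    unfold wt
    exact (h.commute.symm.sub_left ((Commute.refl _).smul_left _)).add_left (Algebra.commutes c _)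
  obtain ⟨ι, hιX, hιY⟩ := exists_algHom_of_commute (R := R) hcomm
  have hιC : ∀ a : R, ι (C (C a)) = algebraMap R A a := fun a => ι.commutes a
  have heC : (1 - C (C (r : R))) * C (C e) = (C (C c) : R[X][X]) := by
    simp only [← he, C_mul, C_sub, C_1]
  have hcC : (C (C (r : R)) - 1) * C (C c) = (C (C φ) : R[X][X]) := by
    simp only [← hc, C_mul, C_sub, C_1]
  set x : R[X][X] := X - C (C e) with hxdef
  set σ := triEquiv r r 0 (C 1 * X ^ 1) with hσdef
  have hσX : σ (C X) = C (C (r : R)) * C X := by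
    rw [hσdef, triEquiv_apply, triHom_X]; simp
  have hσY : σ X = C (C (r : R)) * X + C X := by
    rw [hσdef, triEquiv_apply, triHom_Y]; simp
  have hσC : ∀ a : R, σ (C (C a)) = C (C a) := fun a => σ.commutes a
  have hσx : σ x = C (C (r : R)) * X + C X - C (C e) := by rw [hxdef, map_sub, hσY, hσC]
  have hx : σ (σ x) = ((r : R) + r) • σ x - ((r : R) * r) • x + algebraMap R R[X][X] φ := by
    rw [hσx, map_sub, map_add, map_mul, hσX, hσY, hσC, hσC, hxdef]
    simp only [smul_eq_C_C_mul, algebraMap_eq_C_C, C_mul, C_add]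
    linear_combination hcC + (C (C (r : R)) - 1) * heC
  have hgen : Algebra.adjoin R {x, σ x} = ⊤ := by
    have h1 : x ∈ Algebra.adjoin R {x, σ x} := Algebra.subset_adjoin (by simp)
    have h2 : σ x ∈ Algebra.adjoin R {x, σ x} := Algebra.subset_adjoin (by simp)
    have hY : (X : R[X][X]) = x + C (C e) := by rw [hxdef]; ring
    have hY' : (X : R[X][X]) ∈ Algebra.adjoin R {x, σ x} := by
      have := add_mem h1 (C_C_mem _ e)
      rwa [← hY] at this
    refine adjoin_eq_top_of_mem ?_ hY'
    have hX : (C X : R[X][X]) = σ x - C (C (r : R)) * X + C (C e) := by rw [hσx]; ring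
    have := add_mem (sub_mem h2 (C_C_mul_mem _ (r : R) hY')) (C_C_mem _ e)
    rwa [← hX] at this
  have hιx : ι x = u * d := by rw [hxdef, map_sub, hιY, hιC]; abel
  have hισx : ι (σ x) = d * u := by
    rw [hσx, map_sub, map_add, map_mul, hιX, hιY, hιC, hιC, ← Algebra.smul_def, ← he]
    simp only [wt, Algebra.algebraMap_eq_smul_one]
    module
  refine (h.isWeyl hx hgen hιx hισx).mem_of_mem_center_jordan h hx hgen (fun h0 => ?_)
    (pow_one _).symm one_ne_zero S (by rwa [hιX]) hz
  have := congrArg (fun f => f.coeff 1) h0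
  simp [hxdef] at this

/-- For `r = 1` and `φ ≠ 0` no constant turns `du - s ud` into a weight element. Taken without
constant as `Y`, it satisfies `σ Y = Y + φ`: the Jordan form with exponent `0` and `γ = φ`. -/
theorem IsDownUp.mem_of_mem_center_one [CharZero R] {s : Rˣ}
    (h : IsDownUp ((1 : Rˣ) : R) (s : R) φ u d) {c κ : R} (hφ : φ ≠ 0) (hc : ((s : R) - 1) * c = φ)
    (hκ : κ * ((s : R) - 1) = 1) (S : Subalgebra R A)
    (hS : ∀ i, (s : R) ^ i = 1 → wt 1 c u d ^ i ∈ S) {z : A}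
    (hz : z ∈ Subalgebra.center R A) : z ∈ S := by
  obtain ⟨ι, hιX, hιY⟩ := exists_algHom_of_commute (R := R) (h.commute_wt 1 (s : R) c 0)
  have hιC : ∀ a : R, ι (C (C a)) = algebraMap R A a := fun a => ι.commutes a
  have hκC : C (C κ) * (C (C (s : R)) - 1) = (1 : R[X][X]) := by
    simp only [← C_sub, ← C_mul, hκ, ← C_1]
  have hcC : (C (C (s : R)) - 1) * C (C c) = (C (C φ) : R[X][X]) := by
    simp only [← hc, C_mul, C_sub, C_1]
  set x : R[X][X] := C (C κ) * (C X - X - C (C c)) with hxdef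
  set σ := triEquiv s 1 0 (C φ * X ^ 0) with hσdef
  have hσX : σ (C X) = C (C (s : R)) * C X := by
    rw [hσdef, triEquiv_apply, triHom_X]; simp
  have hσY : σ X = X + C (C φ) := by
    rw [hσdef, triEquiv_apply, triHom_Y]; simp
  have hσC : ∀ a : R, σ (C (C a)) = C (C a) := fun a => σ.commutes a
  have hσx : σ x = C (C κ) * (C (C (s : R)) * C X - (X + C (C φ)) - C (C c)) := by
    rw [hxdef, map_mul, map_sub, map_sub, hσX, hσY, hσC, hσC]
  have hx : σ (σ x) = (((1 : Rˣ) : R) + s) • σ x - (((1 : Rˣ) : R) * s) • x +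
      algebraMap R R[X][X] φ := by
    rw [hσx, map_mul, map_sub, map_sub, map_mul, map_add, hσX, hσY, hσC, hσC, hσC, hσC, hxdef]
    simp only [smul_eq_C_C_mul, algebraMap_eq_C_C, C_mul, C_add, Units.val_one, C_1]
    linear_combination C (C φ) * hκC
  have hgen : Algebra.adjoin R {x, σ x} = ⊤ := by
    have h1 : x ∈ Algebra.adjoin R {x, σ x} := Algebra.subset_adjoin (by simp)
    have h2 : σ x ∈ Algebra.adjoin R {x, σ x} := Algebra.subset_adjoin (by simp)
    have hX : (C X : R[X][X]) = σ x - x + C (C (κ * φ)) := by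
      rw [hσx, hxdef, C_mul, C_mul]
      linear_combination -C X * hκC
    have hX' : C X ∈ Algebra.adjoin R {x, σ x} := by
      have := add_mem (sub_mem h2 h1) (C_C_mem _ (κ * φ))
      rwa [← hX] at this
    refine adjoin_eq_top_of_mem hX' ?_
    have hY : (X : R[X][X]) = C X - C (C ((s : R) - 1)) * x - C (C c) := by
      rw [hxdef, C_sub, C_sub, C_1, C_1]
      linear_combination (C X - X - C (C c)) * hκC
    have := sub_mem (sub_mem hX' (C_C_mul_mem _ ((s : R) - 1) h1)) (C_C_mem _ c)
    rwa [← hY] at this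
  have hιx : ι x = u * d := by
    rw [hxdef, map_mul, map_sub, map_sub, hιX, hιY, hιC, hιC, ← Algebra.smul_def]
    simp only [wt, Algebra.algebraMap_eq_smul_one]
    calc _ = (κ * ((s : R) - 1)) • (u * d) := by module
      _ = _ := by rw [hκ, one_smul]
  have hισx : ι (σ x) = d * u := by
    rw [hσx, map_mul, map_sub, map_sub, map_mul, map_add, hιX, hιY, hιC, hιC, hιC, hιC,
      ← Algebra.smul_def, ← Algebra.smul_def, ← hc]
    simp only [wt, Algebra.algebraMap_eq_smul_one]
    calc _ = (κ * ((s : R) - 1)) • (d * u) := by module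
      _ = _ := by rw [hκ, one_smul]
  refine (h.isWeyl hx hgen hιx hισx).mem_of_mem_center_jordan h hx hgen (fun h0 => ?_)
    (by simp) hφ S (by rwa [hιX]) hz
  have := congrArg (fun f => (f.coeff 1).coeff 0) h0
  have hκ0 : κ ≠ 0 := left_ne_zero_of_mul_eq_one hκ
  simp [hxdef, hκ0, coeff_C] at this

/-- In the coordinates `X = du - ud`, `Y = ud` the automorphism is `X ↦ X + φ`, `Y ↦ Y + X`, and the
invariant `X² - φX - 2φY` becomes `(du - ud)² - φ(du + ud)`. -/
theorem IsDownUp.exists_aeval_of_mem_center_unipotent [CharZero R]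
    (h : IsDownUp ((1 : Rˣ) : R) ((1 : Rˣ) : R) φ u d) (hφ : φ ≠ 0) {z : A}
    (hz : z ∈ Subalgebra.center R A) :
    ∃ f : R[X], z = aeval ((d * u - u * d) ^ 2 - φ • (d * u + u * d)) f := by
  obtain ⟨ι, hιX, hιY⟩ :=
    exists_algHom_of_commute (R := R) (h.commute.symm.sub_left (Commute.refl (u * d)))
  have hιC : ∀ a : R, ι (C (C a)) = algebraMap R A a := fun a => ι.commutes a
  set σ := triEquiv (1 : Rˣ) 1 φ X with hσdef
  have hσX : σ (C X) = C X + C (C φ) := by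
    rw [hσdef, triEquiv_apply, triHom_X]; simp
  have hσY : σ X = X + C X := by
    rw [hσdef, triEquiv_apply, triHom_Y]; simp
  have hx : σ (σ X) = (((1 : Rˣ) : R) + ((1 : Rˣ) : R)) • σ X -
      (((1 : Rˣ) : R) * ((1 : Rˣ) : R)) • X + algebraMap R R[X][X] φ := by
    rw [hσY, map_add, hσX, hσY]
    simp only [Units.val_one, one_mul, one_smul, add_smul, algebraMap_eq_C_C]
    ring
  have hgen : Algebra.adjoin R {X, σ X} = ⊤ := by
    have h1 : X ∈ Algebra.adjoin R {X, σ X} := Algebra.subset_adjoin (by simp)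
    have h2 : σ X ∈ Algebra.adjoin R {X, σ X} := Algebra.subset_adjoin (by simp)
    refine adjoin_eq_top_of_mem ?_ h1
    have hX : (C X : R[X][X]) = σ X - X := by rw [hσY]; ring
    rw [hX]
    exact sub_mem h2 h1
  have hισx : ι (σ X) = d * u := by rw [hσY, map_add, hιX, hιY]; abel
  have hord : ∀ k : ℕ, 0 < k → σ ^ k ≠ 1 := by
    intro k hk h0
    have hpow : ∀ k : ℕ, (σ ^ k) (C X) = C X + C (C (k * φ)) := by
      intro k
      induction k with
      | zero => simp
      | succ k ih =>
        rw [pow_succ', AlgEquiv.mul_apply, ih, map_add, hσX, ← algebraMap_eq_C_C (k * φ),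
          σ.commutes, Nat.cast_succ]
        simp only [algebraMap_eq_C_C, C_mul, C_add, add_mul, one_mul]
        ring
    have h1 := congrArg (fun f => (f.coeff 0).coeff 0) (hpow k)
    rw [h0] at h1
    simp [-map_mul, hφ, hk.ne'] at h1
  obtain ⟨f, rfl, hf⟩ := (h.isWeyl hx hgen hιY hισx).exists_fixed_of_mem_center h hx hgen
    X_ne_zero hord hz
  rw [hσdef, triEquiv_apply] at hf
  obtain ⟨g, hg⟩ := exists_aeval_of_unipotent hφ hf
  refine ⟨g, ?_⟩
  rw [hg, ← aeval_algHom_apply]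
  congr 2
  simp only [two_mul, add_mul, map_sub, map_add, map_mul, map_pow, hιX, hιY, hιC,
    ← Algebra.smul_def, smul_sub, smul_add]
  abel

end Cases

/-! ### Lower bounds: elements that commute with `u` and `d` -/

section Central

variable {R A : Type*} [CommRing R] [Ring A] [Algebra R A] {r s φ : R} {u d : A}

theorem mul_pow_eq_smul {y h : A} {a : R} (ha : y * h = a • (h * y)) (i : ℕ) :
    y * h ^ i = a ^ i • (h ^ i * y) := by
  induction i with
  | zero => simp
  | succ i ih =>
    rw [pow_succ, ← mul_assoc, ih, smul_mul_assoc, mul_assoc, ha, mul_smul_comm, smul_smul,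
      ← pow_succ, ← mul_assoc]

theorem pow_mul_eq_smul {y h : A} {a : R} (ha : h * y = a • (y * h)) (i : ℕ) :
    h ^ i * y = a ^ i • (y * h ^ i) := by
  induction i with
  | zero => simp
  | succ i ih =>
    rw [pow_succ', mul_assoc, ih, mul_smul_comm, ← mul_assoc, ha, smul_mul_assoc, smul_smul,
      ← pow_succ, mul_assoc]

theorem IsDownUpPair.wt_pow_commute (h : IsDownUpPair r s φ u d) {c : R} (hc : (s - 1) * c = φ)
    {i : ℕ} (hi : s ^ i = 1) : Commute (wt r c u d ^ i) u ∧ Commute (wt r c u d ^ i) d := by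
  have h1 := mul_pow_eq_smul (h.d_mul_wt hc) i
  have h2 := pow_mul_eq_smul (h.wt_mul_u hc) i
  rw [hi, one_smul] at h1 h2
  exact ⟨h2, h1.symm⟩

theorem IsDownUpPair.wt_pow_mul_wt_pow_commute (h : IsDownUpPair r s φ u d) {c c' : R}
    (hc : (s - 1) * c = φ) (hc' : (r - 1) * c' = φ) {i j : ℕ} (hij : s ^ i * r ^ j = 1) :
    Commute (wt r c u d ^ i * wt s c' u d ^ j) u ∧
      Commute (wt r c u d ^ i * wt s c' u d ^ j) d := by
  have h1 := mul_pow_eq_smul (h.d_mul_wt hc) i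
  have h2 := pow_mul_eq_smul (h.wt_mul_u hc) i
  have h3 := mul_pow_eq_smul (h.symm.d_mul_wt hc') j
  have h4 := pow_mul_eq_smul (h.symm.wt_mul_u hc') j
  constructor
  · change _ * u = u * _
    rw [mul_assoc, h4, mul_smul_comm, ← mul_assoc, h2, smul_mul_assoc, smul_smul, mul_comm (r ^ j),
      hij, one_smul, mul_assoc]
  · change _ * d = d * _
    rw [← mul_assoc, h1, smul_mul_assoc, mul_assoc _ d, h3, mul_smul_comm, smul_smul, hij, one_smul,
      mul_assoc]

/-- For `m = k + 1`, `u ^ m d = σ ^ (-k) (x) u ^ k` and `d u ^ m = σ (x) u ^ k`; the coefficients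
agree when `σ ^ m = 1`. The argument for `d ^ m` is symmetric. -/
theorem IsWeyl.pow_commute {B : Type*} [CommRing B] [Algebra R B] {σ : B ≃ₐ[R] B} {x : B}
    {ι : B →ₐ[R] A} (h : IsWeyl σ x ι u d) {m : ℕ} (hσ : σ ^ m = 1) :
    Commute (u ^ m) d ∧ Commute (d ^ m) u := by
  cases m with
  | zero => simp
  | succ k =>
    constructor
    · change u ^ (k + 1) * d = d * u ^ (k + 1)
      rw [pow_succ, mul_assoc, h.ud, h.u_pow_mul, pow_mul_comm', ← mul_assoc, h.du]
      congr 3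
      rw [zpow_neg, zpow_natCast, inv_eq_of_mul_eq_one_right (b := σ) (by rw [← pow_succ, hσ])]
    · change d ^ (k + 1) * u = u * d ^ (k + 1)
      rw [pow_succ, mul_assoc, h.du, h.d_pow_mul, pow_mul_comm', ← mul_assoc, h.ud, zpow_natCast,
        ← AlgEquiv.mul_apply, ← pow_succ, hσ, AlgEquiv.one_apply]

theorem IsDownUp.pow_commute [IsDomain R] {r s : Rˣ} (h : IsDownUp (r : R) (s : R) φ u d)
    {c c' κ : R} (hc : ((s : R) - 1) * c = φ) (hc' : ((r : R) - 1) * c' = φ)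
    (hκ : κ * ((s : R) - r) = 1) {m : ℕ} (hr : (r : R) ^ m = 1) (hs : (s : R) ^ m = 1) :
    Commute (u ^ m) d ∧ Commute (d ^ m) u := by
  obtain ⟨x, ι, -, -, hW, -⟩ := h.exists_isWeyl_diag hc hc' hκ
  refine hW.pow_commute (m := m) ?_
  ext1 f
  refine DFunLike.congr_fun (f := ((triEquiv s r 0 0 ^ m : R[X][X] ≃ₐ[R] R[X][X]) :
    R[X][X] →ₐ[R] R[X][X])) (g := AlgHom.id R _) (algHom_ext_XY ?_ ?_) f
  · simpa [hs] using triEquiv_pow_X s r 0 m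
  · simpa [hr] using triEquiv_pow_Y s r m

theorem IsDownUpPair.casimir_commute (h : IsDownUpPair 1 1 φ u d) :
    Commute ((d * u - u * d) ^ 2 - φ • (d * u + u * d)) u ∧
      Commute ((d * u - u * d) ^ 2 - φ • (d * u + u * d)) d := by
  have h1 := h.ddu
  have h2 := h.duu
  have hzu : (d * u - u * d) * u = u * (d * u - u * d) + φ • u := by
    simp only [sub_mul, mul_sub, ← mul_assoc, h2]; module
  have hwu : (d * u + u * d) * u = u * (d * u + u * d) + (2 : R) • (u * (d * u - u * d)) +
      φ • u := by
    simp only [add_mul, mul_add, mul_sub, ← mul_assoc, h2]; module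
  have hzd : d * (d * u - u * d) = (d * u - u * d) * d + φ • d := by
    simp only [sub_mul, mul_sub, ← mul_assoc, h1]; module
  have hwd : d * (d * u + u * d) = (d * u + u * d) * d + (2 : R) • ((d * u - u * d) * d) +
      φ • d := by
    simp only [add_mul, sub_mul, mul_add, ← mul_assoc, h1]; module
  generalize d * u - u * d = z at *
  generalize d * u + u * d = w at *
  constructor
  · change _ * u = u * _
    have : z * (u * z) = u * (z * z) + φ • (u * z) := by
      rw [← mul_assoc, hzu, add_mul, smul_mul_assoc, mul_assoc]
    simp only [pow_two, sub_mul, mul_sub, smul_mul_assoc, mul_smul_comm, mul_assoc, hzu, hwu, mul_add,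
      this]
    module
  · change _ * d = d * _
    have : z * d * z = z * z * d + φ • (z * d) := by
      rw [mul_assoc, hzd, mul_add, mul_smul_comm, mul_assoc]
    simp only [pow_two, sub_mul, mul_sub, smul_mul_assoc, mul_smul_comm, ← mul_assoc, hzd, hwd,
      add_mul, this]
    module

theorem isDownUpPair_algebraMap_iff {K R A : Type*} [CommRing K] [CommRing R] [Ring A] [Algebra K R]
    [Algebra R A] [Algebra K A] [IsScalarTower K R A] {α β r s : K} (hα : α = r + s)
    (hβ : β = -(r * s)) {φ : R} {u d : A} :
    IsDownUpPair (algebraMap K R r) (algebraMap K R s) φ u d ↔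
      d ^ 2 * u = α • (d * u * d) + β • (u * d ^ 2) + algebraMap R A φ * d ∧
      d * u ^ 2 = α • (u * d * u) + β • (u ^ 2 * d) + u * algebraMap R A φ := by
  have h1 : ∀ z : A, (algebraMap K R r + algebraMap K R s) • z = α • z := fun z => by
    rw [hα, ← map_add, algebraMap_smul]
  have h2 : ∀ z : A, (algebraMap K R r * algebraMap K R s) • z = (r * s) • z := fun z => by
    rw [← map_mul, algebraMap_smul]
  constructor
  · intro h
    have h3 := h.ddu
    have h4 := h.duu
    rw [h1, h2, sub_eq_add_neg, ← neg_smul, ← hβ] at h3 h4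
    rw [pow_two, pow_two, h3, ← mul_assoc d u u, h4, ← Algebra.commutes, ← Algebra.smul_def,
      ← Algebra.smul_def, mul_assoc u d d]
    exact ⟨rfl, rfl⟩
  · rintro ⟨h3, h4⟩
    rw [hβ, neg_smul, ← sub_eq_add_neg, pow_two] at h3 h4
    constructor
    · rw [h1, h2, h3, Algebra.smul_def φ, mul_assoc u d d]
    · rw [h1, h2, mul_assoc d u u, h4, Algebra.smul_def φ, Algebra.commutes]

end Central

/-! ### The presented algebra as an algebra over `K[t₁, …, tₙ]` -/

section Instance

variable {K : Type*} [Field K] {n : ℕ} (α β : K) (φ : MvPolynomial (Fin n) K)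

theorem induction_gen {p : DownUpAlgebra α β φ → Prop} (hc : ∀ c : K, p (algebraMap K _ c))
    (hg : ∀ g, p (gen α β φ g)) (hadd : ∀ a b, p a → p b → p (a + b))
    (hmul : ∀ a b, p a → p b → p (a * b)) (a : DownUpAlgebra α β φ) : p a := by
  obtain ⟨x, rfl⟩ := RingQuot.mkAlgHom_surjective K (Rel α β φ) a
  induction x using FreeAlgebra.induction with
  | grade0 c => rw [AlgHom.commutes]; exact hc c
  | grade1 g => exact hg g
  | mul a b ha hb => rw [map_mul]; exact hmul _ _ ha hb
  | add a b ha hb => rw [map_add]; exact hadd _ _ ha hb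

theorem t_mem_center (i : Fin n) : t α β φ i ∈ Subalgebra.center K (DownUpAlgebra α β φ) := by
  rw [Subalgebra.mem_center_iff]
  refine induction_gen α β φ (fun c => Algebra.commutes c _) (fun g => ?_)
    (fun a b ha hb => by rw [add_mul, mul_add, ha, hb])
    (fun a b ha hb => by rw [mul_assoc, hb, ← mul_assoc, ha, mul_assoc])
  simp only [t, gen, ← map_mul]
  cases g with
  | u => exact (RingQuot.mkAlgHom_rel K (Rel.t_u i)).symm
  | d => exact (RingQuot.mkAlgHom_rel K (Rel.t_d i)).symm
  | t j => exact RingQuot.mkAlgHom_rel K (Rel.t_t j i)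

/-- The evaluation of polynomials at the central elements `t₁, …, tₙ`. -/
noncomputable def polyHom :
    MvPolynomial (Fin n) K →ₐ[K] Subalgebra.center K (DownUpAlgebra α β φ) :=
  MvPolynomial.aeval fun i => ⟨t α β φ i, t_mem_center α β φ i⟩

/-- The structure of an algebra over `K[t₁, …, tₙ]`. -/
noncomputable instance polyAlgebra : Algebra (MvPolynomial (Fin n) K) (DownUpAlgebra α β φ) :=
  RingHom.toAlgebra' (((Subalgebra.center K (DownUpAlgebra α β φ)).val.comp
    (polyHom α β φ)).toRingHom)
    fun c x => (Subalgebra.mem_center_iff.1 (polyHom α β φ c).2 x).symm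

theorem algebraMap_poly (p : MvPolynomial (Fin n) K) :
    algebraMap (MvPolynomial (Fin n) K) (DownUpAlgebra α β φ) p = (polyHom α β φ p : _) := rfl

instance : IsScalarTower K (MvPolynomial (Fin n) K) (DownUpAlgebra α β φ) :=
  IsScalarTower.of_algebraMap_eq fun c => by
    rw [algebraMap_poly, MvPolynomial.algebraMap_eq, ← MvPolynomial.algebraMap_eq,
      AlgHom.commutes]; rfl

theorem algebraMap_X (i : Fin n) :
    algebraMap (MvPolynomial (Fin n) K) (DownUpAlgebra α β φ) (MvPolynomial.X i) = t α β φ i := by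
  rw [algebraMap_poly, polyHom, MvPolynomial.aeval_X]

theorem algebraMap_C (c : K) :
    algebraMap (MvPolynomial (Fin n) K) (DownUpAlgebra α β φ) (MvPolynomial.C c) =
      algebraMap K _ c :=
  (IsScalarTower.algebraMap_apply K (MvPolynomial (Fin n) K) (DownUpAlgebra α β φ) c).symm

theorem C_smul (c : K) (a : DownUpAlgebra α β φ) :
    (MvPolynomial.C c : MvPolynomial (Fin n) K) • a = c • a := by
  rw [Algebra.smul_def, algebraMap_C, ← Algebra.smul_def]

/-- Evaluating `freePoly φ` at elements `τ` of a `K`-algebra in which they are the images of the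
variables is evaluating `φ`. -/
theorem map_freePoly {S : Type*} [Ring S] [Algebra K S] (f : FreeAlgebra K (Gen n) →ₐ[K] S)
    (g : MvPolynomial (Fin n) K →ₐ[K] S)
    (hfg : ∀ i, f (FreeAlgebra.ι K (Gen.t i)) = g (MvPolynomial.X i))
    (p : MvPolynomial (Fin n) K) : f (freePoly p) = g p := by
  rw [freePoly, map_sum]
  conv_rhs => rw [p.as_sum, map_sum]
  refine Finset.sum_congr rfl fun m _ => ?_
  rw [map_smul, map_list_prod, List.map_ofFn, MvPolynomial.monomial_eq, map_mul,
    Finsupp.prod_fintype _ _ (fun i => pow_zero _), ← MvPolynomial.algebraMap_eq, AlgHom.commutes,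
    ← Algebra.smul_def, ← List.prod_ofFn, map_list_prod, List.map_ofFn]
  congr 3
  ext i
  simp [hfg]

theorem phi_eq : phi α β φ = algebraMap (MvPolynomial (Fin n) K) (DownUpAlgebra α β φ) φ :=
  map_freePoly (RingQuot.mkAlgHom K (Rel α β φ))
    (IsScalarTower.toAlgHom K (MvPolynomial (Fin n) K) (DownUpAlgebra α β φ))
    (fun i => (algebraMap_X α β φ i).symm) φ

variable {α β φ}

/-- A pair of `R`-linear endomorphisms satisfying the relations extends to the presented algebra by
letting each `tᵢ` act as the scalar `X i`; the result is `R`-linear because it is so on the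
variables. -/
theorem isDownUp {r s : K} (hα : α = r + s) (hβ : β = -(r * s)) :
    IsDownUp (MvPolynomial.C r : MvPolynomial (Fin n) K) (MvPolynomial.C s) φ (u α β φ)
      (d α β φ) where
  toIsDownUpPair := by
    refine (isDownUpPair_algebraMap_iff hα hβ).2 ?_
    have h1 := RingQuot.mkAlgHom_rel K (Rel.ddu (α := α) (β := β) (φ := φ))
    have h2 := RingQuot.mkAlgHom_rel K (Rel.duu (α := α) (β := β) (φ := φ))
    simp only [map_add, map_mul, map_pow, map_smul] at h1 h2
    rw [← phi_eq]
    exact ⟨h1, h2⟩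
  adjoin_eq_top := by
    rw [eq_top_iff]
    rintro a -
    refine induction_gen α β φ (fun c => ?_) (fun g => ?_) (fun a b => add_mem)
      (fun a b => mul_mem) a
    · rw [← algebraMap_C]; exact Subalgebra.algebraMap_mem _ _
    · cases g with
      | u => exact Algebra.subset_adjoin (.inl rfl)
      | d => exact Algebra.subset_adjoin (.inr rfl)
      | t i =>
        change t α β φ i ∈ _
        rw [← algebraMap_X]; exact Subalgebra.algebraMap_mem _ _
  exists_lift M _ _ U D h := by
    let _ : Algebra K (Module.End (MvPolynomial (Fin n) K) M) :=
      Algebra.compHom _ (algebraMap K (MvPolynomial (Fin n) K))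
    have : IsScalarTower K (MvPolynomial (Fin n) K) (Module.End (MvPolynomial (Fin n) K) M) :=
      IsScalarTower.of_algebraMap_eq fun _ => rfl
    let E := Module.End (MvPolynomial (Fin n) K) M
    let f : FreeAlgebra K (Gen n) →ₐ[K] E := FreeAlgebra.lift K fun g => match g with
      | .u => U
      | .d => D
      | .t i => algebraMap (MvPolynomial (Fin n) K) E (MvPolynomial.X i)
    have hfu : f (FreeAlgebra.ι K .u) = U := FreeAlgebra.lift_ι_apply _ _
    have hfd : f (FreeAlgebra.ι K .d) = D := FreeAlgebra.lift_ι_apply _ _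
    have hft : ∀ i, f (FreeAlgebra.ι K (.t i)) =
        algebraMap (MvPolynomial (Fin n) K) E (MvPolynomial.X i) := fun i =>
      FreeAlgebra.lift_ι_apply _ _
    have hfφ : f (freePoly φ) = algebraMap (MvPolynomial (Fin n) K) E φ :=
      map_freePoly f (IsScalarTower.toAlgHom K (MvPolynomial (Fin n) K) E) hft φ
    have hUD := (isDownUpPair_algebraMap_iff hα hβ).1 h
    have hf : ∀ ⦃x y⦄, Rel α β φ x y → f x = f y := by
      intro x y hxy
      cases hxy with
      | t_t i j => simp only [map_mul, hft]; exact Algebra.commutes _ _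
      | t_u i => simp only [map_mul, hft]; exact Algebra.commutes _ _
      | t_d i => simp only [map_mul, hft]; exact Algebra.commutes _ _
      | ddu => simpa only [map_add, map_mul, map_pow, map_smul, hfu, hfd, hfφ] using hUD.1
      | duu => simpa only [map_add, map_mul, map_pow, map_smul, hfu, hfd, hfφ] using hUD.2
    let ρ : DownUpAlgebra α β φ →ₐ[K] E := RingQuot.liftAlgHom K ⟨f, hf⟩
    have hρ : ∀ x, ρ (RingQuot.mkAlgHom K (Rel α β φ) x) = f x := fun x =>
      RingQuot.liftAlgHom_mkAlgHom_apply K f hf x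
    have hρR : ρ.comp (IsScalarTower.toAlgHom K (MvPolynomial (Fin n) K) (DownUpAlgebra α β φ)) =
        IsScalarTower.toAlgHom K (MvPolynomial (Fin n) K) E := by
      refine MvPolynomial.algHom_ext fun i => ?_
      change ρ (algebraMap (MvPolynomial (Fin n) K) (DownUpAlgebra α β φ) (MvPolynomial.X i)) = _
      rw [algebraMap_X]
      exact (hρ _).trans (hft i)
    exact ⟨{ ρ with commutes' := fun p => DFunLike.congr_fun hρR p },
      (hρ _).trans hfu, (hρ _).trans hfd⟩

theorem weightElt_eq (a b : K) : weightElt α β φ a b =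
    wt (MvPolynomial.C a : MvPolynomial (Fin n) K) (MvPolynomial.C (b - 1)⁻¹ * φ) (u α β φ)
      (d α β φ) := by
  rw [weightElt, wt, C_smul, map_mul, ← phi_eq, algebraMap_C, ← Algebra.smul_def]

/-- For `b = 1` the inverse is the default `0`, which is harmless because then `φ = 0`. -/
theorem sub_one_mul_const {b : K} (hb : b ≠ 1 ∨ φ = 0) :
    ((MvPolynomial.C b : MvPolynomial (Fin n) K) - 1) * (MvPolynomial.C (b - 1)⁻¹ * φ) = φ := by
  rcases hb with hb | rfl
  · rw [← MvPolynomial.C_1, ← MvPolynomial.C_sub, ← mul_assoc, ← MvPolynomial.C_mul,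
      mul_inv_cancel₀ (sub_ne_zero.2 hb), MvPolynomial.C_1, one_mul]
  · simp

theorem mem_adjoinT_of_mem_adjoin {S : Set (DownUpAlgebra α β φ)} {z : DownUpAlgebra α β φ}
    (hz : z ∈ Algebra.adjoin (MvPolynomial (Fin n) K) S) : z ∈ adjoinT α β φ S := by
  induction hz using Algebra.adjoin_induction with
  | mem y hy => exact Algebra.subset_adjoin (.inl hy)
  | algebraMap p =>
    induction p using MvPolynomial.induction_on with
    | C c => rw [algebraMap_C]; exact Subalgebra.algebraMap_mem _ _
    | add p q hp hq => rw [map_add]; exact add_mem hp hq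
    | mul_X p i hp =>
      rw [map_mul, algebraMap_X]
      exact mul_mem hp (Algebra.subset_adjoin (.inr ⟨i, rfl⟩))
  | add y z _ _ hy hz => exact add_mem hy hz
  | mul y z _ _ hy hz => exact mul_mem hy hz

/-- Being central does not depend on the base ring, and adjoining over `K[t₁, …, tₙ]` amounts to
adjoining the `tᵢ` over `K`. -/
theorem center_eq_adjoinT {r s : K} (hα : α = r + s) (hβ : β = -(r * s))
    {S : Set (DownUpAlgebra α β φ)}
    (hle : ∀ z ∈ Subalgebra.center (MvPolynomial (Fin n) K) (DownUpAlgebra α β φ),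
      z ∈ Algebra.adjoin (MvPolynomial (Fin n) K) S)
    (hS : ∀ z ∈ S, Commute z (u α β φ) ∧ Commute z (d α β φ)) :
    Subalgebra.center K (DownUpAlgebra α β φ) = adjoinT α β φ S := by
  refine le_antisymm (fun z hz => mem_adjoinT_of_mem_adjoin (hle z ?_)) ?_
  · rw [Subalgebra.mem_center_iff] at hz ⊢
    exact hz
  · rw [adjoinT, Algebra.adjoin_le_iff]
    rintro z (hz | ⟨i, rfl⟩)
    · have := mem_center_of_commute (isDownUp hα hβ) (hS z hz).1 (hS z hz).2
      rw [SetLike.mem_coe]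
      rw [Subalgebra.mem_center_iff] at this ⊢
      exact this
    · exact t_mem_center α β φ i

end Instance

/-! ### The center in each case -/

section CenterCases

variable {K : Type*} [Field K] {n : ℕ} {α β : K} {φ : MvPolynomial (Fin n) K} {r s : K}

theorem C_pow_eq_one {x : K} {i : ℕ} (h : (MvPolynomial.C x : MvPolynomial (Fin n) K) ^ i = 1) :
    x ^ i = 1 := by
  rw [← MvPolynomial.C_pow, ← MvPolynomial.C_1] at h
  exact MvPolynomial.C_injective _ _ h

theorem C_pow_mul_pow_eq_one {x y : K} {i j : ℕ}
    (h : (MvPolynomial.C x : MvPolynomial (Fin n) K) ^ i * MvPolynomial.C y ^ j = 1) :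
    x ^ i * y ^ j = 1 := by
  rw [← MvPolynomial.C_pow, ← MvPolynomial.C_pow, ← MvPolynomial.C_mul, ← MvPolynomial.C_1] at h
  exact MvPolynomial.C_injective _ _ h

theorem C_inv_mul {x : K} (hx : x ≠ 0) :
    (MvPolynomial.C x⁻¹ : MvPolynomial (Fin n) K) * MvPolynomial.C x = 1 := by
  rw [← MvPolynomial.C_mul, inv_mul_cancel₀ hx, MvPolynomial.C_1]

/-- A nonzero constant as a unit of the polynomial ring. -/
noncomputable def constUnit (n : ℕ) {x : K} (hx : x ≠ 0) : (MvPolynomial (Fin n) K)ˣ :=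
  Units.map (MvPolynomial.C : K →+* MvPolynomial (Fin n) K).toMonoidHom (Units.mk0 x hx)

theorem val_constUnit {x : K} (hx : x ≠ 0) :
    (constUnit n hx : MvPolynomial (Fin n) K) = MvPolynomial.C x := rfl

theorem IsRootOfUnity.ne_zero {x : K} (hx : IsRootOfUnity x) : x ≠ 0 := by
  rintro rfl
  obtain ⟨k, hk, h⟩ := hx
  simp [hk.ne'] at h

theorem IsRootOfUnity.one : IsRootOfUnity (1 : K) := ⟨1, one_pos, one_pow 1⟩

theorem ne_one_of_not_isRootOfUnity {x : K} (hx : ¬ IsRootOfUnity x) : x ≠ 1 := by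
  rintro rfl
  exact hx IsRootOfUnity.one

theorem HasOrder.pos {x : K} {m : ℕ} (h : HasOrder φ x m) : 0 < m := by
  have := h.2
  omega

theorem HasOrder.isRootOfUnity {x : K} {m : ℕ} (h : HasOrder φ x m) : IsRootOfUnity x :=
  ⟨m, h.pos, h.1.pow_eq_one⟩

theorem HasOrder.ne_one_or {x : K} {m : ℕ} (h : HasOrder φ x m) : x ≠ 1 ∨ φ = 0 := by
  rcases h.2 with h1 | h1
  · exact .inl (h.1.ne_one h1)
  · exact .inr h1.2

theorem exists_hasOrder {x : K} (hx : IsRootOfUnity x) (h1 : x ≠ 1 ∨ φ = 0) :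
    ∃ m, HasOrder φ x m := by
  obtain ⟨k, hk, hxk⟩ := hx
  obtain ⟨m, hm, h⟩ := IsPrimitiveRoot.exists_pos hxk hk.ne'
  refine ⟨m, h, ?_⟩
  by_cases hm1 : m = 1
  · subst hm1
    exact .inr ⟨rfl, h1.resolve_left (not_not.2 (IsPrimitiveRoot.one_right_iff.1 h))⟩
  · exact .inl (by omega)

/-- Every central element lies in a subalgebra that contains the monomials `H ^ i L ^ j` of weight
one and the powers of `u` and `d` of weight one. -/
theorem mem_adjoin_of_mem_center_diag (hα : α = r + s) (hβ : β = -(r * s)) (hrs : r ≠ s)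
    (hr0 : r ≠ 0) (hs0 : s ≠ 0) (hr : r ≠ 1 ∨ φ = 0) (hs : s ≠ 1 ∨ φ = 0)
    (S : Subalgebra (MvPolynomial (Fin n) K) (DownUpAlgebra α β φ))
    (hS : ∀ i j, s ^ i * r ^ j = 1 → weightElt α β φ r s ^ i * weightElt α β φ s r ^ j ∈ S)
    (hud : ∀ k, s ^ k = 1 → r ^ k = 1 → u α β φ ^ k ∈ S ∧ d α β φ ^ k ∈ S)
    {z : DownUpAlgebra α β φ}
    (hz : z ∈ Subalgebra.center (MvPolynomial (Fin n) K) (DownUpAlgebra α β φ)) : z ∈ S := by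
  have h := isDownUp (φ := φ) hα hβ
  rw [← val_constUnit hr0, ← val_constUnit hs0] at h
  refine h.mem_of_mem_center_diag (sub_one_mul_const hs) (sub_one_mul_const hr)
    (κ := MvPolynomial.C (s - r)⁻¹) ?_ S (fun i j hij => ?_) (fun k hk hk' => ?_) hz
  · rw [val_constUnit, val_constUnit, ← MvPolynomial.C_sub]
    exact C_inv_mul (sub_ne_zero.2 hrs.symm)
  · have := hS i j (C_pow_mul_pow_eq_one hij)
    rwa [weightElt_eq, weightElt_eq] at this
  · exact hud k (C_pow_eq_one hk) (C_pow_eq_one hk')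

theorem mem_adjoin_of_mem_center_zero (hα : α = r + 0) (hβ : β = -(r * 0)) (hr : r ≠ 1 ∨ φ = 0)
    (S : Subalgebra (MvPolynomial (Fin n) K) (DownUpAlgebra α β φ))
    (hS : ∀ i, r ^ i = 1 → weightElt α β φ 0 r ^ i ∈ S) {z : DownUpAlgebra α β φ}
    (hz : z ∈ Subalgebra.center (MvPolynomial (Fin n) K) (DownUpAlgebra α β φ)) : z ∈ S := by
  have h := isDownUp (φ := φ) hα hβ
  rw [MvPolynomial.C_0] at h
  refine h.mem_of_mem_center_of_zero (sub_one_mul_const hr) (Subalgebra.toSubmodule S)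
    (fun i hi => ?_) hz
  have := hS i (C_pow_eq_one hi)
  rwa [weightElt_eq, MvPolynomial.C_0] at this

theorem mem_adjoin_of_mem_center_equal [CharZero K] (hα : α = r + r) (hβ : β = -(r * r))
    (hr : r ≠ 1 ∨ φ = 0) (S : Subalgebra (MvPolynomial (Fin n) K) (DownUpAlgebra α β φ))
    (hS : ∀ i, r ^ i = 1 → weightElt α β φ r r ^ i ∈ S) {z : DownUpAlgebra α β φ}
    (hz : z ∈ Subalgebra.center (MvPolynomial (Fin n) K) (DownUpAlgebra α β φ)) : z ∈ S := by
  by_cases hr0 : r = 0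
  · subst hr0
    exact mem_adjoin_of_mem_center_zero hα hβ hr S hS hz
  have h := isDownUp (φ := φ) hα hβ
  rw [← val_constUnit hr0] at h
  refine h.mem_of_mem_center_equal (sub_one_mul_const (b := r) hr)
    -- This is `c / (1 - r)`; for `r = 1`, where `φ = 0`, it is `0`.
    (e := -(MvPolynomial.C (r - 1)⁻¹ * (MvPolynomial.C (r - 1)⁻¹ * φ))) ?_ S (fun i hi => ?_) hz
  · have := sub_one_mul_const (φ := MvPolynomial.C (r - 1)⁻¹ * φ) (b := r)
      (hr.imp id fun h => by rw [h, mul_zero])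
    rw [val_constUnit]
    linear_combination this
  · have := hS i (C_pow_eq_one hi)
    rwa [weightElt_eq] at this

theorem mem_adjoin_of_mem_center_one [CharZero K] (hα : α = 1 + s) (hβ : β = -(1 * s)) (hφ : φ ≠ 0)
    (hs : s ≠ 1) (S : Subalgebra (MvPolynomial (Fin n) K) (DownUpAlgebra α β φ))
    (hS : ∀ i, s ^ i = 1 → weightElt α β φ 1 s ^ i ∈ S) {z : DownUpAlgebra α β φ}
    (hz : z ∈ Subalgebra.center (MvPolynomial (Fin n) K) (DownUpAlgebra α β φ)) : z ∈ S := by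
  have h := isDownUp (φ := φ) hα hβ
  by_cases hs0 : s = 0
  · subst hs0
    rw [MvPolynomial.C_0, MvPolynomial.C_1] at h
    obtain ⟨a, rfl⟩ := h.mem_range_of_mem_center_of_one_zero hφ hz
    exact S.algebraMap_mem a
  rw [← val_constUnit hs0, MvPolynomial.C_1] at h
  refine h.mem_of_mem_center_one hφ (sub_one_mul_const (.inl hs))
    (κ := MvPolynomial.C (s - 1)⁻¹) ?_ S (fun i hi => ?_) hz
  · rw [val_constUnit, ← MvPolynomial.C_1, ← MvPolynomial.C_sub]
    exact C_inv_mul (sub_ne_zero.2 hs)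
  · have := hS i (C_pow_eq_one hi)
    rwa [weightElt_eq, MvPolynomial.C_1] at this

theorem weightElt_pow_commute (hα : α = r + s) (hβ : β = -(r * s)) (hs : s ≠ 1 ∨ φ = 0) {i : ℕ}
    (hi : s ^ i = 1) : Commute (weightElt α β φ r s ^ i) (u α β φ) ∧
      Commute (weightElt α β φ r s ^ i) (d α β φ) := by
  rw [weightElt_eq]
  refine (isDownUp hα hβ).wt_pow_commute (sub_one_mul_const hs) ?_
  rw [← MvPolynomial.C_pow, hi, MvPolynomial.C_1]

theorem weightElt_pow_mul_pow_commute (hα : α = r + s) (hβ : β = -(r * s)) (hr : r ≠ 1 ∨ φ = 0)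
    (hs : s ≠ 1 ∨ φ = 0) {i j : ℕ} (hij : s ^ i * r ^ j = 1) :
    Commute (weightElt α β φ r s ^ i * weightElt α β φ s r ^ j) (u α β φ) ∧
      Commute (weightElt α β φ r s ^ i * weightElt α β φ s r ^ j) (d α β φ) := by
  rw [weightElt_eq, weightElt_eq]
  refine (isDownUp hα hβ).wt_pow_mul_wt_pow_commute (sub_one_mul_const hs) (sub_one_mul_const hr) ?_
  rw [← MvPolynomial.C_pow, ← MvPolynomial.C_pow, ← MvPolynomial.C_mul, hij, MvPolynomial.C_1]

theorem gen_pow_commute (hα : α = r + s) (hβ : β = -(r * s)) (hrs : r ≠ s)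
    (hr : r ≠ 1 ∨ φ = 0) (hs : s ≠ 1 ∨ φ = 0) (hr0 : r ≠ 0) (hs0 : s ≠ 0) {m : ℕ}
    (hrm : r ^ m = 1) (hsm : s ^ m = 1) :
    Commute (u α β φ ^ m) (d α β φ) ∧ Commute (d α β φ ^ m) (u α β φ) := by
  have h := isDownUp (φ := φ) hα hβ
  rw [← val_constUnit hr0, ← val_constUnit hs0] at h
  refine h.pow_commute (sub_one_mul_const hs) (sub_one_mul_const hr)
    (κ := MvPolynomial.C (s - r)⁻¹) ?_ ?_ ?_
  · rw [val_constUnit, val_constUnit, ← MvPolynomial.C_sub]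
    exact C_inv_mul (sub_ne_zero.2 hrs.symm)
  · rw [val_constUnit, ← MvPolynomial.C_pow, hrm, MvPolynomial.C_1]
  · rw [val_constUnit, ← MvPolynomial.C_pow, hsm, MvPolynomial.C_1]

theorem pow_mem_adjoin_pow {R A : Type*} [CommRing R] [Ring A] [Algebra R A] (x : A) {m i : ℕ}
    (h : m ∣ i) : x ^ i ∈ Algebra.adjoin R {x ^ m} := by
  obtain ⟨k, rfl⟩ := h
  rw [pow_mul]
  exact pow_mem (Algebra.subset_adjoin (Set.mem_singleton (x ^ m))) k

theorem center_caseEqual [CharZero K] (hα : α = r + r) (hβ : β = -(r * r)) {m : ℕ}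
    (hm : HasOrder φ r m) :
    Subalgebra.center K (DownUpAlgebra α β φ) = adjoinT α β φ {weightElt α β φ r r ^ m} := by
  refine center_eq_adjoinT hα hβ (fun z hz => mem_adjoin_of_mem_center_equal hα hβ hm.ne_one_or _
    (fun i hi => pow_mem_adjoin_pow _ (hm.1.dvd_of_pow_eq_one i hi)) hz) ?_
  rintro _ rfl
  exact weightElt_pow_commute hα hβ hm.ne_one_or hm.1.pow_eq_one

theorem center_caseUnipotent [CharZero K] (hα : α = 1 + 1) (hβ : β = -(1 * 1)) (hφ : φ ≠ 0) :
    Subalgebra.center K (DownUpAlgebra α β φ) = adjoinT α β φ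
      {(d α β φ * u α β φ - u α β φ * d α β φ) ^ 2
        - phi α β φ * (d α β φ * u α β φ + u α β φ * d α β φ)} := by
  have h := isDownUp (φ := φ) hα hβ
  rw [MvPolynomial.C_1] at h
  rw [phi_eq, ← Algebra.smul_def]
  refine center_eq_adjoinT hα hβ (fun z hz => ?_) ?_
  · obtain ⟨f, rfl⟩ := h.exists_aeval_of_mem_center_unipotent hφ hz
    exact aeval_mem_adjoin_singleton _ _
  · rintro _ rfl
    exact h.casimir_commute

theorem center_caseOneRoot (hα : α = r + s) (hβ : β = -(r * s)) {m : ℕ}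
    (h : CaseOneRoot φ r s m) :
    Subalgebra.center K (DownUpAlgebra α β φ) = adjoinT α β φ {weightElt α β φ s r ^ m} := by
  obtain ⟨hm, hs⟩ := h
  refine center_eq_adjoinT hα hβ (fun z hz => ?_) ?_
  · by_cases hs0 : s = 0
    · subst hs0
      exact mem_adjoin_of_mem_center_zero hα hβ hm.ne_one_or _
        (fun i hi => pow_mem_adjoin_pow _ (hm.1.dvd_of_pow_eq_one i hi)) hz
    · refine mem_adjoin_of_mem_center_diag hα hβ (fun h => hs (h ▸ hm.isRootOfUnity))
        hm.isRootOfUnity.ne_zero hs0 hm.ne_one_or (.inl (ne_one_of_not_isRootOfUnity hs)) _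
        (fun i j hij => ?_) (fun k hk _ => ?_) hz
      -- Raising `s ^ i r ^ j = 1` to the power `m` removes `r` and leaves `s ^ (i m) = 1`,
      -- impossible for `i > 0`.
      · have hi : i = 0 := by
          by_contra hi
          refine hs ⟨i * m, Nat.mul_pos (Nat.pos_of_ne_zero hi) hm.pos, ?_⟩
          have := congrArg (· ^ m) hij
          simp only [mul_pow, one_pow] at this
          rwa [← pow_mul r, mul_comm j, pow_mul, hm.1.pow_eq_one, one_pow, mul_one, ← pow_mul]
            at this
        subst hi
        rw [pow_zero, one_mul] at hij ⊢
        exact pow_mem_adjoin_pow _ (hm.1.dvd_of_pow_eq_one j hij)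
      · obtain rfl : k = 0 := by
          by_contra hk0
          exact hs ⟨k, Nat.pos_of_ne_zero hk0, hk⟩
        simp only [pow_zero]
        exact ⟨one_mem _, one_mem _⟩
  · rintro _ rfl
    rw [add_comm] at hα
    rw [mul_comm] at hβ
    exact weightElt_pow_commute hα hβ hm.ne_one_or hm.1.pow_eq_one

theorem center_caseNoRoot (hα : α = r + s) (hβ : β = -(r * s)) (h : CaseNoRoot r s) :
    Subalgebra.center K (DownUpAlgebra α β φ) = adjoinT α β φ
      {z | ∃ i j : ℕ, r ^ i * s ^ j = 1 ∧
        z = weightElt α β φ r s ^ j * weightElt α β φ s r ^ i} := by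
  obtain ⟨hrs, hr, hs⟩ := h
  have hk : ∀ {x : K}, ¬ IsRootOfUnity x → ∀ {k : ℕ}, x ^ k = 1 → k = 0 := by
    intro x hx k hxk
    by_contra hk0
    exact hx ⟨k, Nat.pos_of_ne_zero hk0, hxk⟩
  have hr1 := ne_one_of_not_isRootOfUnity hr
  have hs1 := ne_one_of_not_isRootOfUnity hs
  refine center_eq_adjoinT hα hβ (fun z hz => ?_) ?_
  -- A zero root is not a root of unity, so it falls in this case. The center is then trivial, since
  -- the other root has no positive power equal to `1`.
  · by_cases hs0 : s = 0
    · subst hs0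
      refine mem_adjoin_of_mem_center_zero hα hβ (.inl hr1) _ (fun i hi => ?_) hz
      rw [hk hr hi, pow_zero]
      exact one_mem _
    by_cases hr0 : r = 0
    · subst hr0
      rw [add_comm] at hα
      rw [mul_comm] at hβ
      refine mem_adjoin_of_mem_center_zero hα hβ (.inl hs1) _ (fun i hi => ?_) hz
      rw [hk hs hi, pow_zero]
      exact one_mem _
    refine mem_adjoin_of_mem_center_diag hα hβ hrs hr0 hs0 (.inl hr1) (.inl hs1) _
      (fun i j hij => ?_) (fun k hsk _ => ?_) hz
    · exact Algebra.subset_adjoin ⟨j, i, by rw [mul_comm, hij], rfl⟩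
    · rw [hk hs hsk, pow_zero, pow_zero]
      exact ⟨one_mem _, one_mem _⟩
  · rintro _ ⟨i, j, hij, rfl⟩
    exact weightElt_pow_mul_pow_commute hα hβ (.inl hr1) (.inl hs1) (by rw [mul_comm, hij])

theorem center_caseBothRoots (hα : α = r + s) (hβ : β = -(r * s)) {m₁ m₂ : ℕ}
    (h : CaseBothRoots φ r s m₁ m₂) :
    Subalgebra.center K (DownUpAlgebra α β φ) = adjoinT α β φ
      ({d α β φ ^ Nat.lcm m₁ m₂, u α β φ ^ Nat.lcm m₁ m₂} ∪
        {z | ∃ i j : ℕ, s ^ i * r ^ j = 1 ∧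
          z = weightElt α β φ r s ^ i * weightElt α β φ s r ^ j}) := by
  obtain ⟨hrs, hr, hs⟩ := h
  refine center_eq_adjoinT hα hβ (fun z hz => ?_) ?_
  · refine mem_adjoin_of_mem_center_diag hα hβ hrs hr.isRootOfUnity.ne_zero
      hs.isRootOfUnity.ne_zero hr.ne_one_or hs.ne_one_or _ (fun i j hij => ?_)
      (fun k hsk hrk => ?_) hz
    · exact Algebra.subset_adjoin (.inr ⟨i, j, hij, rfl⟩)
    · have hdvd : Nat.lcm m₁ m₂ ∣ k :=
        Nat.lcm_dvd (hr.1.dvd_of_pow_eq_one k hrk) (hs.1.dvd_of_pow_eq_one k hsk)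
      exact ⟨Algebra.adjoin_mono (by simp) (pow_mem_adjoin_pow (u α β φ) hdvd),
        Algebra.adjoin_mono (by simp) (pow_mem_adjoin_pow (d α β φ) hdvd)⟩
  · have hud := gen_pow_commute (φ := φ) hα hβ hrs hr.ne_one_or hs.ne_one_or
      hr.isRootOfUnity.ne_zero hs.isRootOfUnity.ne_zero
      ((hr.1.pow_eq_one_iff_dvd _).2 (Nat.dvd_lcm_left m₁ m₂))
      ((hs.1.pow_eq_one_iff_dvd _).2 (Nat.dvd_lcm_right m₁ m₂))
    rintro _ ((rfl | rfl) | ⟨i, j, hij, rfl⟩)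
    · exact ⟨hud.2, (Commute.refl _).pow_left _⟩
    · exact ⟨(Commute.refl _).pow_left _, hud.1⟩
    · exact weightElt_pow_mul_pow_commute hα hβ hr.ne_one_or hs.ne_one_or hij

theorem center_caseOneIsOne [CharZero K] (hα : α = r + s) (hβ : β = -(r * s)) {m : ℕ}
    (h : CaseOneIsOne φ r s m) :
    Subalgebra.center K (DownUpAlgebra α β φ) = adjoinT α β φ {weightElt α β φ r s ^ m} := by
  obtain ⟨hφ, rfl, hm, hm1⟩ := h
  have hs1 := hm.ne_one hm1
  refine center_eq_adjoinT hα hβ (fun z hz => mem_adjoin_of_mem_center_one hα hβ hφ hs1 _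
    (fun i hi => pow_mem_adjoin_pow _ (hm.dvd_of_pow_eq_one i hi)) hz) ?_
  rintro _ rfl
  exact weightElt_pow_commute hα hβ (.inl hs1) hm.pow_eq_one

theorem center_equal_of_not_isRootOfUnity [CharZero K] (hα : α = r + r) (hβ : β = -(r * r))
    (hr : ¬ IsRootOfUnity r) :
    Subalgebra.center K (DownUpAlgebra α β φ) = adjoinT α β φ ∅ := by
  refine center_eq_adjoinT hα hβ (fun z hz => mem_adjoin_of_mem_center_equal hα hβ
    (.inl (ne_one_of_not_isRootOfUnity hr)) _ (fun i hi => ?_) hz) (fun _ h => h.elim)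
  obtain rfl : i = 0 := by
    by_contra hi0
    exact hr ⟨i, Nat.pos_of_ne_zero hi0, hi⟩
  rw [pow_zero]
  exact one_mem _

theorem center_one_of_not_isRootOfUnity [CharZero K] (hα : α = 1 + s) (hβ : β = -(1 * s))
    (hφ : φ ≠ 0) (hs : ¬ IsRootOfUnity s) :
    Subalgebra.center K (DownUpAlgebra α β φ) = adjoinT α β φ ∅ := by
  refine center_eq_adjoinT hα hβ (fun z hz => mem_adjoin_of_mem_center_one hα hβ hφ
    (ne_one_of_not_isRootOfUnity hs) _ (fun i hi => ?_) hz) (fun _ h => h.elim)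
  obtain rfl : i = 0 := by
    by_contra hi0
    exact hs ⟨i, Nat.pos_of_ne_zero hi0, hi⟩
  rw [pow_zero]
  exact one_mem _

/-- If none of the cases applies, then `r = s` is not a root of unity, or `φ ≠ 0` and one of `r`,
`s` is `1` and the other is not a root of unity. -/
theorem center_remaining [CharZero K] (hα : α = r + s) (hβ : β = -(r * s))
    (h1 : ¬ ∃ m, CaseEqual φ r s m) (h2 : ¬ CaseUnipotent φ α β)
    (h3 : ¬ ∃ m, CaseOneRoot φ r s m) (h4 : ¬ ∃ m, CaseOneRoot φ s r m) (h5 : ¬ CaseNoRoot r s)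
    (h6 : ¬ ∃ m₁ m₂, CaseBothRoots φ r s m₁ m₂) (h7 : ¬ ∃ m, CaseOneIsOne φ r s m)
    (h8 : ¬ ∃ m, CaseOneIsOne φ s r m) :
    Subalgebra.center K (DownUpAlgebra α β φ) = adjoinT α β φ ∅ := by
  have hone : ∀ {x y : K}, IsRootOfUnity y → x ≠ y → φ ≠ 0 → x = 1 →
      ∃ m, CaseOneIsOne φ x y m := by
    intro x y hy hxy hφ hx
    subst hx
    obtain ⟨m, hm⟩ := exists_hasOrder (φ := φ) hy (.inl hxy.symm)
    exact ⟨m, hφ, rfl, hm.1, hm.2.resolve_right fun h => hφ h.2⟩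
  by_cases hrs : r = s
  · subst hrs
    by_cases hr : IsRootOfUnity r
    · by_cases hr1 : r ≠ 1 ∨ φ = 0
      · obtain ⟨m, hm⟩ := exists_hasOrder hr hr1
        exact absurd ⟨m, rfl, hm⟩ h1
      · push Not at hr1
        obtain ⟨rfl, hφ⟩ := hr1
        exact absurd ⟨by rw [hα]; norm_num, by rw [hβ]; norm_num, hφ⟩ h2
    · exact center_equal_of_not_isRootOfUnity hα hβ hr
  · have hα' : α = s + r := by rw [hα, add_comm]
    have hβ' : β = -(s * r) := by rw [hβ, mul_comm]
    by_cases hr : IsRootOfUnity r <;> by_cases hs : IsRootOfUnity s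
    · by_cases hr1 : r ≠ 1 ∨ φ = 0
      · by_cases hs1 : s ≠ 1 ∨ φ = 0
        · obtain ⟨m₁, hm₁⟩ := exists_hasOrder hr hr1
          obtain ⟨m₂, hm₂⟩ := exists_hasOrder hs hs1
          exact absurd ⟨m₁, m₂, hrs, hm₁, hm₂⟩ h6
        · push Not at hs1
          exact absurd (hone hr (Ne.symm hrs) hs1.2 hs1.1) h8
      · push Not at hr1
        exact absurd (hone hs hrs hr1.2 hr1.1) h7
    · by_cases hr1 : r ≠ 1 ∨ φ = 0
      · obtain ⟨m, hm⟩ := exists_hasOrder hr hr1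
        exact absurd ⟨m, hm, hs⟩ h3
      · push Not at hr1
        obtain ⟨rfl, hφ⟩ := hr1
        exact center_one_of_not_isRootOfUnity hα hβ hφ hs
    · by_cases hs1 : s ≠ 1 ∨ φ = 0
      · obtain ⟨m, hm⟩ := exists_hasOrder hs hs1
        exact absurd ⟨m, hm, hr⟩ h4
      · push Not at hs1
        obtain ⟨rfl, hφ⟩ := hs1
        exact center_one_of_not_isRootOfUnity hα' hβ' hφ hr
    · exact absurd ⟨hrs, hr, hs⟩ h5

end CenterCases

end DownUp

open DownUp Polynomial in
theorem theorem1p5 {K : Type*} [Field K] [CharZero K] (n : ℕ) (α β : K)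
    (φ : MvPolynomial (Fin n) K) (r s : K)
    (hrs : (X ^ 2 - C α * X - C β : K[X]) = (X - C r) * (X - C s)) :
    (∀ m : ℕ, CaseEqual φ r s m →
      Subalgebra.center K (DownUpAlgebra α β φ) =
        adjoinT α β φ {weightElt α β φ r r ^ m}) ∧
    (CaseUnipotent φ α β →
      Subalgebra.center K (DownUpAlgebra α β φ) =
        adjoinT α β φ
          {(d α β φ * u α β φ - u α β φ * d α β φ) ^ 2
            - phi α β φ * (d α β φ * u α β φ + u α β φ * d α β φ)}) ∧
    (∀ m : ℕ, CaseOneRoot φ r s m →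
      Subalgebra.center K (DownUpAlgebra α β φ) =
        adjoinT α β φ {weightElt α β φ s r ^ m}) ∧
    (∀ m : ℕ, CaseOneRoot φ s r m →
      Subalgebra.center K (DownUpAlgebra α β φ) =
        adjoinT α β φ {weightElt α β φ r s ^ m}) ∧
    (CaseNoRoot r s →
      Subalgebra.center K (DownUpAlgebra α β φ) =
        adjoinT α β φ
          {z | ∃ i j : ℕ, r ^ i * s ^ j = 1 ∧
            z = weightElt α β φ r s ^ j * weightElt α β φ s r ^ i}) ∧
    (∀ m₁ m₂ : ℕ, CaseBothRoots φ r s m₁ m₂ →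
      Subalgebra.center K (DownUpAlgebra α β φ) =
        adjoinT α β φ
          ({d α β φ ^ Nat.lcm m₁ m₂, u α β φ ^ Nat.lcm m₁ m₂} ∪
            {z | ∃ i j : ℕ, s ^ i * r ^ j = 1 ∧
              z = weightElt α β φ r s ^ i * weightElt α β φ s r ^ j})) ∧
    (∀ m : ℕ, CaseOneIsOne φ r s m →
      Subalgebra.center K (DownUpAlgebra α β φ) =
        adjoinT α β φ {weightElt α β φ r s ^ m}) ∧
    (∀ m : ℕ, CaseOneIsOne φ s r m →
      Subalgebra.center K (DownUpAlgebra α β φ) =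
        adjoinT α β φ {weightElt α β φ s r ^ m}) ∧
    ((¬ ∃ m, CaseEqual φ r s m) → ¬ CaseUnipotent φ α β →
      (¬ ∃ m, CaseOneRoot φ r s m) → (¬ ∃ m, CaseOneRoot φ s r m) →
      ¬ CaseNoRoot r s → (¬ ∃ m₁ m₂, CaseBothRoots φ r s m₁ m₂) →
      (¬ ∃ m, CaseOneIsOne φ r s m) → (¬ ∃ m, CaseOneIsOne φ s r m) →
      Subalgebra.center K (DownUpAlgebra α β φ) = adjoinT α β φ ∅) := by
  -- The constant coefficient gives `-β = rs`, and the value at `1` then gives `α = r + s`.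
  have h0 := congrArg (fun p => p.coeff 0) hrs
  have h1 := congrArg (fun p => p.eval 1) hrs
  simp [mul_coeff_zero] at h0
  simp at h1
  have hβ : β = -(r * s) := by linear_combination -h0
  have hα : α = r + s := by linear_combination h0 - h1
  have hα' : α = s + r := by rw [hα, add_comm]
  have hβ' : β = -(s * r) := by rw [hβ, mul_comm]
  refine ⟨?_, ?_, fun m => center_caseOneRoot hα hβ, fun m => center_caseOneRoot hα' hβ',
    center_caseNoRoot hα hβ, fun m₁ m₂ => center_caseBothRoots hα hβ,
    fun m => center_caseOneIsOne hα hβ, fun m => center_caseOneIsOne hα' hβ',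
    center_remaining hα hβ⟩
  · rintro m ⟨rfl, hm⟩
    exact center_caseEqual hα hβ hm
  · rintro ⟨h2, h3, hφ⟩
    exact center_caseUnipotent (by rw [h2]; norm_num) (by rw [h3]; norm_num) hφ
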